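/- Let $k$ be an even integer and let $s\in\mathbb C$ with $1<\mathrm{Re}(s)<k/2-1$. Let $\Gamma\subset \mathrm{PSL}_2(\mathbb R)$ be a Fuchsian group of the first kind (a discrete subgroup for which $\Gamma\backslash\mathbb H^*$ is compact, where $\mathbb H^*$ is the upper half-plane $\mathbb H$ together with the cusps of $\Gamma$), let $\mathfrak a$ be a cusp of $\Gamma$, and let $\sigma_{\mathfrak a}\in \mathrm{SL}_2(\mathbb R)$ be a scaling matrix for it: $\sigma_{\mathfrak a}\infty=\mathfrak a$ and $\sigma_{\mathfrak a}^{-1}\Gamma_{\mathfrak a}\sigma_{\mathfrak a}=\{\pm\begin{pmatrix}1&m\\0&1\end{pmatrix}: m\in\mathbb Z\}$, where $\Gamma_{\mathfrak a}$ is the stabilizer of $\mathfrak a$ in $\Gamma$. With $j(\begin{pmatrix}a&b\\c&d\end{pmatrix},z)=cz+d$ and the principal branch of the power, put for $z\in\mathbb H$ and $\tau\in\mathbb H\cup\mathbb R$ $$\Omega_{\mathfrak a}(z,\tau;s,k)=\sum_{\gamma\in\Gamma}\frac{1}{(\sigma_{\mathfrak a}^{-1}\gamma z-\overline\tau)^{s}\,j(\sigma_{\mathfrak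 a}^{-1}\gamma,z)^{k}}.$$ Let $f\in S_k(\Gamma)$ be a cusp form of weight $k$, with expansion $j(\sigma_{\mathfrak a},z)^{-k}f(\sigma_{\mathfrak a}z)=\sum_{m\ge1}a_{\mathfrak a}(m)e^{2\pi imz}$ at $\mathfrak a$. For $\mu\in\mathbb H\cup\mathbb R$ and $\mathrm{Re}(w)>(k+1)/2$ put $$L^*_{\mathfrak a}(\overline f,w;\mu)=(2\pi)^{-w}\,\Gamma(w)\sum_{m=1}^\infty\frac{\overline{a_{\mathfrak a}(m)}\,e^{2\pi im\mu}}{m^{w}},$$ and let $\langle g,h\rangle=\int_{\Gamma\backslash\mathbb H}y^kg(z)\overline{h(z)}\,\frac{dx\,dy}{y^2}$ be the Petersson product. Then for all $\tau\in\mathbb H\cup\mathbb R$ the series $\Omega_{\mathfrak a}(z,\tau;s,k)$ converges absolutely for every $z\in\mathbb H$, the integral defining $\langle\Omega_{\mathfrak a}(\cdot,\tau;s,k),f\rangle$ and the series defining $L^*_{\mathfrak a}(\overline f,k-s;-\overline\tau)$ converge absolutely, and $$\langle\Omega_{\mathfrak a}(\cdot,\tau;s,k),f\rangle=2^{2-k}\pi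 e^{-s\pi i/2}\,\frac{\Gamma(k-1)}{\Gamma(s)\Gamma(k-s)}\,L^*_{\mathfrak a}(\overline f,k-s;-\overline\tau).$$ Moreover, let $\Gamma=\mathrm{PSL}_2(\mathbb Z)$ and let $\mathcal C_k(z,s)=\sum_{\gamma\in\Gamma}(\gamma z)^{-s}j(\gamma,z)^{-k}$, which is $\Omega_\infty(z,0;s,k)$ with $\sigma_\infty=I$. For $f\in S_k(\Gamma)$ let $\overline f(z):=\overline{f(-\overline z)}$ and $L^*(\overline f,s)=\int_0^\infty\overline f(iy)\,y^{s-1}\,dy$. There is exactly one $\mathcal D_k(\cdot,s)\in S_k(\Gamma)$ with $\langle\mathcal D_k(\cdot,s),f\rangle=L^*(\overline f,s)$ for all $f\in S_k(\Gamma)$, and for all $z\in\mathbb H$ $$\mathcal C_k(z,s)=2^{2-k}(-1)^{k/2}\pi e^{-s\pi i/2}\,\frac{\Gamma(k-1)}{\Gamma(s)\Gamma(k-s)}\,\mathcal D_k(z,s).$$ -/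

import Mathlib

open scoped UpperHalfPlane MatrixGroups ModularForm ComplexConjugate
open MeasureTheory

noncomputable section

namespace OmegaKernel

/-- The class in `PSL(2, ℝ)` of a matrix in `SL(2, ℝ)`. -/
abbrev toPSL : SL(2, ℝ) →* PSL(2, ℝ) :=
  QuotientGroup.mk' (Subgroup.center SL(2, ℝ))

/-- `PSL(2, ℝ)` acts on the upper half-plane by Moebius transformations. -/
instance pslAction : MulAction PSL(2, ℝ) ℍ :=
  MulAction.compHom ℍ (Matrix.ProjectiveSpecialLinearGroup.toPGL (n := Fin 2) (R := ℝ))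

theorem toPSL_smul (g : SL(2, ℝ)) (z : ℍ) : toPSL g • z = g • z := rfl

/-- For even `k` (see `autPow_toPSL`): the factor `j(g, z) ^ k`, where `j(g, z) = c z + d` for
`g = ± (a b; c d)`. The two representatives of `g` differ by a sign, so it is well defined. -/
def autPow (k : ℤ) (g : PSL(2, ℝ)) (z : ℍ) : ℂ :=
  UpperHalfPlane.denom (Quotient.out g : SL(2, ℝ)) z ^ k

theorem autPow_toPSL {k : ℤ} (hk : Even k) (g : SL(2, ℝ)) (z : ℍ) :
    autPow k (toPSL g) z = ((g 1 0 : ℂ) * z + g 1 1) ^ k := by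
  unfold autPow
  have h : toPSL (Quotient.out (toPSL g) : SL(2, ℝ)) = toPSL g := Quotient.out_eq _
  rw [QuotientGroup.mk'_eq_mk'] at h
  obtain ⟨u, hu, hgu⟩ := h
  rw [Matrix.SpecialLinearGroup.mem_center_iff] at hu
  obtain ⟨r, hr, hru⟩ := hu
  generalize (Quotient.out (toPSL g) : SL(2, ℝ)) = g' at hgu ⊢
  have hr' : r = 1 ∨ r = -1 := by simpa using hr
  have key : ∀ j, g 1 j = g' 1 j * r := by
    intro j
    rw [← hgu, Matrix.SpecialLinearGroup.coe_mul, ← hru]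
    simp [Matrix.mul_apply, Fin.sum_univ_two]
    fin_cases j <;> simp
  have hd : UpperHalfPlane.denom (g' : GL (Fin 2) ℝ) z = (g' 1 0 : ℂ) * z + g' 1 1 := rfl
  rw [hd, key 0, key 1]
  rcases hr' with rfl | rfl
  · simp
  · rw [← hk.neg_zpow]
    congr 1
    push_cast
    ring

/-- The full preimage in `SL(2, ℝ)` of a subgroup of `PSL(2, ℝ)`. -/
abbrev preSL (Γ : Subgroup PSL(2, ℝ)) : Subgroup SL(2, ℝ) := Γ.comap toPSL

/-- The same preimage, as a subgroup of `GL(2, ℝ)`; cusps and cusp forms of `Γ` are those of this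
group in Mathlib's sense. -/
abbrev preGL (Γ : Subgroup PSL(2, ℝ)) : Subgroup (GL (Fin 2) ℝ) :=
  (preSL Γ).map Matrix.SpecialLinearGroup.toGL

/-! ### Fuchsian groups of the first kind -/

/-- The extended upper half-plane `ℍ*`: the union of `ℍ` and the set of cusps of `Γ`. -/
inductive ExtHalfPlane (Γ : Subgroup PSL(2, ℝ)) : Type
  | point (z : ℍ) : ExtHalfPlane Γ
  | cusp (c : OnePoint ℝ) (hc : IsCusp c (preGL Γ)) : ExtHalfPlane Γ

open ExtHalfPlane in
/-- The usual topology of `ℍ*`: a set is open if its part in `ℍ` is open and if, with a cusp `c`, it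
contains a horodisc `g {Im z > A}` at `c = g ∞`. (Two matrices `g` with `g ∞ = c` give the same
horodiscs, so it makes no difference whether one or all of them are considered.) -/
instance (Γ : Subgroup PSL(2, ℝ)) : TopologicalSpace (ExtHalfPlane Γ) where
  IsOpen U := IsOpen {z : ℍ | point z ∈ U} ∧
    ∀ c hc, cusp c hc ∈ U →
      ∀ g : SL(2, ℝ), (g : GL (Fin 2) ℝ) • (OnePoint.infty : OnePoint ℝ) = c →
        ∃ A : ℝ, ∀ z : ℍ, A < z.im → point (g • z) ∈ U
  isOpen_univ := ⟨by simp, fun _ _ _ _ _ => ⟨0, fun _ _ => Set.mem_univ _⟩⟩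
  isOpen_inter U V hU hV := by
    refine ⟨hU.1.inter hV.1, fun c hc hm g hg => ?_⟩
    obtain ⟨A, hA⟩ := hU.2 c hc hm.1 g hg
    obtain ⟨B, hB⟩ := hV.2 c hc hm.2 g hg
    exact ⟨max A B, fun z hz =>
      ⟨hA z ((le_max_left A B).trans_lt hz), hB z ((le_max_right A B).trans_lt hz)⟩⟩
  isOpen_sUnion S hS := by
    refine ⟨?_, fun c hc hm g hg => ?_⟩
    · have h : {z : ℍ | (point z : ExtHalfPlane Γ) ∈ ⋃₀ S} =
          ⋃ U ∈ S, {z : ℍ | (point z : ExtHalfPlane Γ) ∈ U} := by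
        ext z; simp
      rw [h]
      exact isOpen_biUnion fun U hU => (hS U hU).1
    · obtain ⟨U, hU, hcU⟩ := hm
      obtain ⟨A, hA⟩ := (hS U hU).2 c hc hcU g hg
      exact ⟨A, fun z hz => ⟨U, hU, hA z hz⟩⟩

/-- Two points of `ℍ*` are related if an element of `Γ` maps the first to the second. -/
def orbitRel (Γ : Subgroup PSL(2, ℝ)) : ExtHalfPlane Γ → ExtHalfPlane Γ → Prop
  | .point z, .point w => ∃ γ ∈ Γ, γ • z = w
  | .cusp c _, .cusp d _ => ∃ γ ∈ preGL Γ, γ • c = d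
  | _, _ => False

/-- A Fuchsian group of the first kind: a discrete subgroup `Γ` of `PSL(2, ℝ)` such that `Γ \ ℍ*` is
compact (equivalently, `Γ` is discrete of finite covolume). -/
structure IsFuchsianFirstKind (Γ : Subgroup PSL(2, ℝ)) : Prop where
  discrete : DiscreteTopology (preSL Γ)
  compact : CompactSpace (Quot (orbitRel Γ))

/-- `σ` is a scaling matrix for the cusp `a` of `Γ`: it maps `∞` to `a`, and `σ⁻¹ Γ_a σ` consists of
the classes of the matrices `± (1 m; 0 1)` with `m` an integer. -/
structure IsScalingMatrix (Γ : Subgroup PSL(2, ℝ)) (a : OnePoint ℝ) (σ : SL(2, ℝ)) : Prop where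
  map_infty : (σ : GL (Fin 2) ℝ) • (OnePoint.infty : OnePoint ℝ) = a
  conj_stabilizer : ∀ g : SL(2, ℝ),
    (σ * g * σ⁻¹ ∈ preSL Γ ∧ ((σ * g * σ⁻¹ : SL(2, ℝ)) : GL (Fin 2) ℝ) • a = a) ↔
      ∃ m : ℤ, (g : Matrix (Fin 2) (Fin 2) ℝ) = !![1, (m : ℝ); 0, 1] ∨
        (g : Matrix (Fin 2) (Fin 2) ℝ) = -!![1, (m : ℝ); 0, 1]

/-! ### The series, the inner product, and the `L`-functions -/

/-- The term of the series `Ω_a` at `γ`. The complex power is the principal one. -/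
def omegaTerm (σ : SL(2, ℝ)) (k : ℤ) (s τ : ℂ) (z : ℍ) (γ : PSL(2, ℝ)) : ℂ :=
  1 / ((((((toPSL σ)⁻¹ * γ) • z : ℍ) : ℂ) - conj τ) ^ s * autPow k ((toPSL σ)⁻¹ * γ) z)

/-- The series `Ω_a(z, τ; s, k)`, formed with the scaling matrix `σ` of the cusp `a`. -/
def Omega (Γ : Subgroup PSL(2, ℝ)) (σ : SL(2, ℝ)) (k : ℤ) (s τ : ℂ) (z : ℍ) : ℂ :=
  ∑' γ : Γ, omegaTerm σ k s τ z γ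

/-- The integrand `f(z) conj(g(z)) y ^ k` of the Petersson inner product. -/
def peterssonIntegrand (k : ℤ) (f g : ℍ → ℂ) (z : ℍ) : ℂ :=
  f z * conj (g z) * (z.im : ℂ) ^ k

/-- The Petersson inner product, as an integral over a fundamental domain `F` for the invariant
measure `dx dy / y ^ 2`. -/
def peterssonInner (F : Set ℍ) (k : ℤ) (f g : ℍ → ℂ) : ℂ :=
  ∫ z in F, peterssonIntegrand k f g z

/-- The Fourier coefficients at the cusp `a` with scaling matrix `σ`:
`j(σ, z) ^ (-k) f(σ z) = ∑ a(m) exp(2 π i m z)`. -/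
def fourierCoeffAt (σ : SL(2, ℝ)) (k : ℤ) (f : ℍ → ℂ) (m : ℕ) : ℂ :=
  (UpperHalfPlane.qExpansion 1 (f ∣[k] (σ : GL (Fin 2) ℝ))).coeff m

/-- The coefficients `a(m) exp(2 π i m μ)` of the twisted `L`-series. -/
def twist (a : ℕ → ℂ) (μ : ℂ) (m : ℕ) : ℂ :=
  a m * Complex.exp (2 * Real.pi * Complex.I * m * μ)

/-- The completed twisted `L`-function `(2π) ^ (-s) Γ(s) ∑_{m ≥ 1} a(m) exp(2 π i m μ) m ^ (-s)`. -/
def twistedLStar (a : ℕ → ℂ) (s μ : ℂ) : ℂ :=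
  (2 * Real.pi : ℂ) ^ (-s) * Complex.Gamma s * LSeries (twist a μ) s

/-- The Fourier coefficients at `a` of the conjugate form of `f`, that is, the complex conjugates of
the Fourier coefficients of `f` at `a`. -/
def conjFourierCoeffAt (σ : SL(2, ℝ)) (k : ℤ) (f : ℍ → ℂ) (m : ℕ) : ℂ :=
  conj (fourierCoeffAt σ k f m)

/-! ### The modular group -/

/-- `PSL(2, ℤ)`, as a subgroup of `PSL(2, ℝ)`. -/
def modularPSL : Subgroup PSL(2, ℝ) :=
  (toPSL.comp (Matrix.SpecialLinearGroup.map (Int.castRingHom ℝ))).range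

/-- The conjugate form `z ↦ conj (f (- conj z))`; it has the conjugate Fourier coefficients. -/
def conjForm (f : ℍ → ℂ) (z : ℍ) : ℂ := conj (f (UpperHalfPlane.J • z))

/-- The completed `L`-function `L*(f, s) = ∫_0^∞ f(i y) y ^ (s - 1) dy` of a cusp form for the
modular group; the integral converges for all complex `s`. -/
def LStar (f : ℍ → ℂ) (s : ℂ) : ℂ :=
  mellin (fun y : ℝ => f (UpperHalfPlane.ofComplex (Complex.I * y))) s

/-- `D` is the kernel `D_k(·, s)` of `L*(·, s)`: the cusp form for the modular group whose Petersson
product with each cusp form `f` is `L*` of the conjugate form of `f`, at `s`. -/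
def IsLStarKernel (F : Set ℍ) (k : ℤ) (s : ℂ) (D : CuspForm (preGL modularPSL) k) : Prop :=
  ∀ f : CuspForm (preGL modularPSL) k, peterssonInner F k D f = LStar (conjForm f) s

/-- Cohen's series `C_k(z, s) = ∑_γ (γ z) ^ (-s) j(γ, z) ^ (-k)` over the modular group, i.e. the
series `Ω_∞(z, 0; s, k)`. -/
def cohenSeries (k : ℤ) (s : ℂ) (z : ℍ) : ℂ := Omega modularPSL 1 k s 0 z

end OmegaKernel

end

open scoped Pointwise Manifold

noncomputable section

namespace OmegaKernel

/-! ### The action of `PSL(2, ℝ)` and its discrete subgroups -/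

/-! The proof is Rankin–Selberg unfolding, with each element of `Γ ⊂ PSL(2, ℝ)` counted once. Put `φ
= f ∣[k] σ` and `u(z) = (z - conj τ)^(-s) conj(φ z) y^k`. Modularity of `f` turns the `γ`-th term of
the series times `conj(f z) y^k` into `u(σ⁻¹ γ z)` (`omegaTerm_mul`), so the integral over a
fundamental domain of the sum over all of `Γ` is the integral of `u` over `ℍ`
(`hasSum_integral_smul`).

That integral is computed in coordinates from the Fourier expansion of `φ`. Along a horizontal line,
Fourier inversion of `t^(s-1) e^(-2πct)` on `t > 0` gives `m^(s-1)` and the phase `e^(-sπi/2)`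
(`integral_cpow_horizontal`). The `y`-integral is then a Gamma integral giving `Γ(k-1) (4πm)^(1-k)`
(`integral_laplace`), and the powers of `m` combine to the Dirichlet series at `k - s`
(`tsum_laplace`).

The analytic input is that `|f| y^(k/2)` is bounded, by compactness of `Γ \ ℍ*`
(`exists_bound_of_isFuchsianFirstKind`). It gives Hecke's bound `a(m) = O(m^(k/2))`, and with decay
at the cusp a majorant of `u` that is integrable because `1 < Re s < k/2`. Unfolding this majorant
also shows that its sum over an orbit is finite for almost every base point. Convergence at every
point follows because term sizes at two points are comparable (`termSize_le`) and the orbit heights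
are bounded, so the exponential factor can be removed (`exists_im_smul_le`).

For the modular group, dominated convergence makes Cohen's series a cusp form (`cohenForm`). The
formula with `σ = 1`, `τ = 0` and the functional equation, the source of `(-1)^(k/2)`, show that a
nonzero multiple of it represents `L*(conj f, s)` (`petersson_cohenSeries`). This gives existence of
the kernel, and definiteness of the Petersson product gives uniqueness
(`eq_zero_of_petersson_self`). -/

theorem exists_toPSL_eq (g : PSL(2, ℝ)) : ∃ M : SL(2, ℝ), toPSL M = g :=
  QuotientGroup.mk'_surjective _ g

instance : SMulInvariantMeasure PSL(2, ℝ) ℍ volume where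
  measure_preimage_smul g s hs := by
    obtain ⟨M, rfl⟩ := exists_toPSL_eq g
    exact measure_preimage_smul (volume : Measure ℍ) (M : GL (Fin 2) ℝ) s

instance : ContinuousConstSMul PSL(2, ℝ) ℍ where
  continuous_const_smul g := by
    obtain ⟨M, rfl⟩ := exists_toPSL_eq g
    exact continuous_const_smul (M : GL (Fin 2) ℝ)

/-- A discrete subgroup of a second countable group is countable. Countability is what permits
exchanging sums over `Γ` with integrals. -/
theorem countable_of_discrete {Γ : Subgroup PSL(2, ℝ)} (h : DiscreteTopology (preSL Γ)) :
    Countable Γ := by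
  have : SecondCountableTopology (Matrix (Fin 2) (Fin 2) ℝ) :=
    inferInstanceAs (SecondCountableTopology (Fin 2 → Fin 2 → ℝ))
  have : SecondCountableTopology SL(2, ℝ) :=
    Matrix.SpecialLinearGroup.isClosedEmbedding_val.isEmbedding.secondCountableTopology
  have : Countable (preSL Γ) := countable_of_Lindelof_of_discrete
  have hs : Function.Surjective fun g : preSL Γ => (⟨toPSL g, g.2⟩ : Γ) := by
    rintro ⟨g, hg⟩
    obtain ⟨M, rfl⟩ := exists_toPSL_eq g
    exact ⟨⟨M, hg⟩, rfl⟩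
  exact hs.countable

theorem SL_im_smul (M : SL(2, ℝ)) (z : ℍ) :
    (M • z).im = z.im / Complex.normSq ((M 1 0 : ℂ) * z + M 1 1) := by
  have h := UpperHalfPlane.im_smul_eq_div_normSq (M : GL (Fin 2) ℝ) z
  have h2 : |((M : GL (Fin 2) ℝ).det.val : ℝ)| = 1 := by simp
  rw [h2, one_mul] at h
  exact h

theorem SL_denom_ne_zero (M : SL(2, ℝ)) (z : ℍ) : (M 1 0 : ℂ) * z + M 1 1 ≠ 0 :=
  UpperHalfPlane.denom_ne_zero (M : GL (Fin 2) ℝ) z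

theorem SL_smul_coe (M : SL(2, ℝ)) (z : ℍ) :
    ((M • z : ℍ) : ℂ) = ((M 0 0 : ℂ) * z + M 0 1) / ((M 1 0 : ℂ) * z + M 1 1) :=
  UpperHalfPlane.coe_specialLinearGroup_apply M z

theorem SL_slash_apply (k : ℤ) (f : ℍ → ℂ) (M : SL(2, ℝ)) (z : ℍ) :
    (f ∣[k] (M : GL (Fin 2) ℝ)) z = f (M • z) * ((M 1 0 : ℂ) * z + M 1 1) ^ (-k) := by
  simp [ModularForm.slash_def, UpperHalfPlane.σ, UpperHalfPlane.denom]
  left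
  rfl

theorem dist_toPSL_smul (g : PSL(2, ℝ)) (z w : ℍ) : dist (g • z) (g • w) = dist z w := by
  obtain ⟨M, rfl⟩ := exists_toPSL_eq g
  rw [toPSL_smul, toPSL_smul]
  exact dist_smul M z w

/-- This is `Im(g z) = Im z / |j(g, z)|^2` raised to the power `k/2`. -/
theorem norm_autPow {k : ℤ} (hk : Even k) (g : PSL(2, ℝ)) (z : ℍ) :
    ‖autPow k g z‖ * (g • z).im ^ ((k : ℝ) / 2) = z.im ^ ((k : ℝ) / 2) := by
  obtain ⟨M, rfl⟩ := exists_toPSL_eq g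
  rw [autPow_toPSL hk, toPSL_smul, SL_im_smul, norm_zpow, Complex.normSq_eq_norm_sq]
  have hj : 0 < ‖(M 1 0 : ℂ) * z + M 1 1‖ := norm_pos_iff.2 (SL_denom_ne_zero M z)
  rw [Real.div_rpow z.im_pos.le (by positivity), ← Real.rpow_natCast, ← Real.rpow_mul hj.le,
    ← Real.rpow_intCast]
  rw [show ((2 : ℕ) : ℝ) * ((k : ℝ) / 2) = k by push_cast; ring]
  field_simp

theorem autPow_ne_zero {k : ℤ} (hk : Even k) (g : PSL(2, ℝ)) (z : ℍ) : autPow k g z ≠ 0 := by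
  obtain ⟨M, rfl⟩ := exists_toPSL_eq g
  rw [autPow_toPSL hk]
  exact zpow_ne_zero _ (SL_denom_ne_zero M z)

/-! ### Unfolding over a fundamental domain -/

/-- The translates of `F` tile `ℍ`, and the extra left factor `g` is harmless by invariance of the
measure. No finiteness is assumed, so the identity can itself prove finiteness: of orbit sums almost
everywhere, and of the covolume. -/
theorem lintegral_tsum_smul {Γ : Subgroup PSL(2, ℝ)} [Countable Γ] {F : Set ℍ}
    (hF : IsFundamentalDomain Γ F volume) (g : PSL(2, ℝ)) {u : ℍ → ENNReal} (hu : Measurable u) :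
    ∫⁻ z in F, ∑' γ : Γ, u ((g * γ) • z) = ∫⁻ z, u z := by
  have hm : ∀ γ : Γ, Measurable fun z : ℍ => u ((g * (γ : PSL(2, ℝ))) • z) := fun γ =>
    hu.comp (measurable_const_smul (g * (γ : PSL(2, ℝ))))
  rw [lintegral_tsum fun γ => (hm γ).aemeasurable]
  have h := hF.lintegral_eq_tsum'' fun z => u (g • z)
  simp only [Subgroup.smul_def, smul_smul] at h
  rw [← h]
  exact (measurePreserving_smul g (volume : Measure ℍ)).lintegral_comp hu

/-- The nonnegative version applied to `‖u‖ₑ` justifies exchanging sum and integral. -/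
theorem hasSum_integral_smul {Γ : Subgroup PSL(2, ℝ)} [Countable Γ] {F : Set ℍ}
    (hF : IsFundamentalDomain Γ F volume) (g : PSL(2, ℝ)) {u : ℍ → ℂ} (hu : Integrable u)
    (hum : Measurable u) :
    IntegrableOn (fun z => ∑' γ : Γ, u ((g * γ) • z)) F ∧
      ∫ z in F, ∑' γ : Γ, u ((g * γ) • z) = ∫ z, u z := by
  have hm : ∀ γ : Γ, Measurable fun z : ℍ => u ((g * (γ : PSL(2, ℝ))) • z) := fun γ =>
    hum.comp (measurable_const_smul (g * (γ : PSL(2, ℝ))))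
  have hl := lintegral_tsum_smul hF g (u := fun z => ‖u z‖ₑ) hum.enorm
  have hfin : ∫⁻ z in F, ∑' γ : Γ, ‖u ((g * γ) • z)‖ₑ ≠ ⊤ := by
    rw [hl]; exact hu.2.ne
  constructor
  · refine ⟨(Measurable.tsum hm).aestronglyMeasurable, ?_⟩
    refine lt_of_le_of_lt (lintegral_mono fun z => ?_) hfin.lt_top
    exact enorm_tsum_le_tsum_enorm
  · have hfin' : ∑' γ : Γ, ∫⁻ z in F, ‖u ((g * γ) • z)‖ₑ ≠ ⊤ := by
      rw [← lintegral_tsum fun γ => (hm γ).enorm.aemeasurable]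
      exact hfin
    have h0 := integral_tsum (μ := volume.restrict F) (fun γ => (hm γ).aestronglyMeasurable) hfin'
    refine h0.trans ?_
    have h := hF.integral_eq_tsum'' (fun z => u (g • z))
      ((measurePreserving_smul g (volume : Measure ℍ)).integrable_comp_of_integrable hu)
    simp only [Subgroup.smul_def, smul_smul] at h
    rw [← h]
    exact integral_smul_eq_self (μ := volume) u (g := g)

/-! ### Integration over the upper half-plane in coordinates -/

/-- The product measure `dx dy` on `ℝ × (0, ∞)`. -/
def stripMeasure : Measure (ℝ × ℝ) := (volume : Measure ℝ).prod (volume.restrict (Set.Ioi 0))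

theorem measurableEmbedding_re_im :
    MeasurableEmbedding fun z : ℍ => ((z.re, z.im) : ℝ × ℝ) :=
  Complex.measurableEquivRealProd.measurableEmbedding.comp UpperHalfPlane.measurableEmbedding_coe

theorem measurePreserving_re_im :
    MeasurePreserving (fun z : ℍ => ((z.re, z.im) : ℝ × ℝ))
      ((volume : Measure ℂ).comap UpperHalfPlane.coe) stripMeasure := by
  have h1 : MeasurePreserving UpperHalfPlane.coe ((volume : Measure ℂ).comap UpperHalfPlane.coe)
      ((volume : Measure ℂ).restrict (Set.range UpperHalfPlane.coe)) :=
    ⟨UpperHalfPlane.measurable_coe, by rw [UpperHalfPlane.measurableEmbedding_coe.map_comap]⟩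
  have h2 := Complex.volume_preserving_equiv_real_prod.restrict_preimage
    (s := Set.univ ×ˢ Set.Ioi (0 : ℝ)) (MeasurableSet.univ.prod measurableSet_Ioi)
  have h3 : Complex.measurableEquivRealProd ⁻¹' (Set.univ ×ˢ Set.Ioi (0 : ℝ)) =
      Set.range UpperHalfPlane.coe := by
    ext z
    simp [Complex.measurableEquivRealProd_apply]
  have h4 : (volume : Measure (ℝ × ℝ)).restrict (Set.univ ×ˢ Set.Ioi (0 : ℝ)) = stripMeasure := by
    rw [stripMeasure, Measure.volume_eq_prod, ← Measure.prod_restrict, Measure.restrict_univ]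
  rw [h3, h4] at h2
  exact h2.comp h1

theorem measurable_density : Measurable fun z : ℍ => (1 / NNReal.mk z.im z.im_pos.le) ^ 2 := by
  refine Measurable.pow_const (measurable_const.div ?_) 2
  exact (UpperHalfPlane.continuous_im.subtype_mk _).measurable

theorem ofComplex_re_im (z : ℍ) :
    UpperHalfPlane.ofComplex ((z.re : ℂ) + z.im * Complex.I) = z := by
  rw [show ((z.re : ℂ) + z.im * Complex.I) = z from Complex.re_add_im (z : ℂ),
    UpperHalfPlane.ofComplex_apply]

section Coordinates

variable {E : Type*} [NormedAddCommGroup E] [NormedSpace ℝ E]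

theorem density_smul (u : ℍ → E) (z : ℍ) :
    ((1 / NNReal.mk z.im z.im_pos.le) ^ 2 : NNReal) • u z =
      ((fun p : ℝ × ℝ => (p.2 ^ 2)⁻¹ •
        u (UpperHalfPlane.ofComplex ((p.1 : ℂ) + p.2 * Complex.I))) (z.re, z.im)) := by
  simp only [ofComplex_re_im]
  rw [NNReal.smul_def]
  simp

/-- The invariant measure has density `y^(-2)` with respect to `dx dy`. The values that `ofComplex`
takes for `y ≤ 0` are irrelevant, since `stripMeasure` lives on `y > 0`. -/
theorem integrable_iff_coord (u : ℍ → E) :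
    Integrable u ↔ Integrable (fun p : ℝ × ℝ => (p.2 ^ 2)⁻¹ •
        u (UpperHalfPlane.ofComplex ((p.1 : ℂ) + p.2 * Complex.I))) stripMeasure := by
  rw [UpperHalfPlane.volume_def, integrable_withDensity_iff_integrable_smul measurable_density,
    ← measurePreserving_re_im.integrable_comp_emb measurableEmbedding_re_im]
  refine iff_of_eq (congrArg (fun v => Integrable v _) (funext fun z => ?_))
  exact density_smul u z

theorem integral_eq_coord (u : ℍ → E) :
    ∫ z, u z = ∫ p : ℝ × ℝ, (p.2 ^ 2)⁻¹ •
        u (UpperHalfPlane.ofComplex ((p.1 : ℂ) + p.2 * Complex.I)) ∂stripMeasure := by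
  rw [UpperHalfPlane.volume_def, integral_withDensity_eq_integral_smul measurable_density,
    ← measurePreserving_re_im.integral_comp measurableEmbedding_re_im]
  exact integral_congr_ae (Filter.Eventually.of_forall fun z => density_smul u z)

end Coordinates

/-! ### Integrals of powers along horizontal lines -/

theorem integrable_norm_rpow {r c : ℝ} (hr : 1 < r) (hc : 0 < c) :
    Integrable fun x : ℝ => ‖(x : ℂ) + c * Complex.I‖ ^ (-r) := by
  have h := (integrable_rpow_neg_one_add_norm_sq (E := ℝ) (μ := volume) (r := r)
    (by simpa using hr)).comp_div hc.ne'
  have h2 := h.const_mul (c ^ (-r))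
  refine h2.congr (Filter.Eventually.of_forall fun x => ?_)
  have hx : ‖(x : ℂ) + c * Complex.I‖ = (c ^ 2 * (1 + ‖x / c‖ ^ 2)) ^ ((1 : ℝ) / 2) := by
    rw [Complex.norm_add_mul_I, Real.sqrt_eq_rpow]
    congr 1
    rw [Real.norm_eq_abs, sq_abs]
    field_simp
    ring
  simp only
  rw [hx, ← Real.rpow_mul (by positivity), Real.mul_rpow (by positivity) (by positivity),
    ← Real.rpow_natCast c 2, ← Real.rpow_mul hc.le]
  congr 2 <;> (push_cast; ring)

/-- Scaling `x = c v`. The explicit power of `c` decides convergence near the real axis in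
`integrable_majorant`. -/
theorem integral_norm_rpow (r : ℝ) {c : ℝ} (hc : 0 < c) :
    ∫ x : ℝ, ‖(x : ℂ) + c * Complex.I‖ ^ (-r) =
      c ^ (1 - r) * ∫ x : ℝ, ‖(x : ℂ) + Complex.I‖ ^ (-r) := by
  have h := Measure.integral_comp_div (fun x : ℝ => ‖(x : ℂ) + Complex.I‖ ^ (-r)) c
  rw [abs_of_pos hc, smul_eq_mul] at h
  have h2 : ∀ x : ℝ, ‖(x : ℂ) + c * Complex.I‖ ^ (-r) =
      c ^ (-r) * ‖((x / c : ℝ) : ℂ) + Complex.I‖ ^ (-r) := by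
    intro x
    rw [← Real.mul_rpow hc.le (norm_nonneg _)]
    congr 1
    have hc' : (c : ℂ) ≠ 0 := by exact_mod_cast hc.ne'
    have h3 : (x : ℂ) + c * Complex.I = c * (((x / c : ℝ) : ℂ) + Complex.I) := by
      push_cast
      field_simp
    rw [h3, norm_mul, Complex.norm_real, Real.norm_of_nonneg hc.le]
  simp_rw [h2]
  rw [integral_const_mul, h, ← mul_assoc, ← Real.rpow_add_one hc.ne']
  congr 2
  ring

/-! ### The Laplace transform of a power -/

theorem integrableOn_rpow_mul_exp {p b : ℝ} (hp : -1 < p) (hb : 0 < b) :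
    IntegrableOn (fun t : ℝ => t ^ p * Real.exp (-(b * t))) (Set.Ioi 0) := by
  have h := integrableOn_rpow_mul_exp_neg_mul_rpow (p := 1) hp one_pos hb
  simpa using h

theorem norm_cpow_mul_exp {a r : ℂ} {t : ℝ} (ht : 0 < t) :
    ‖(t : ℂ) ^ (a - 1) * Complex.exp (-(r * t))‖ =
      t ^ (a.re - 1) * Real.exp (-(r.re * t)) := by
  rw [norm_mul, Complex.norm_cpow_eq_rpow_re_of_pos ht, Complex.norm_exp]
  simp

theorem aestronglyMeasurable_cpow_mul_exp (a r : ℂ) :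
    AEStronglyMeasurable (fun t : ℝ => (t : ℂ) ^ (a - 1) * Complex.exp (-(r * t)))
      (volume.restrict (Set.Ioi 0)) := by
  refine ContinuousOn.aestronglyMeasurable (fun t ht => ?_) measurableSet_Ioi
  refine ContinuousAt.continuousWithinAt (ContinuousAt.mul ?_ (by fun_prop))
  exact Complex.continuousAt_ofReal_cpow_const _ _ (Or.inr (ne_of_gt ht))

theorem integrableOn_cpow_mul_exp {a r : ℂ} (ha : 0 < a.re) (hr : 0 < r.re) :
    IntegrableOn (fun t : ℝ => (t : ℂ) ^ (a - 1) * Complex.exp (-(r * t))) (Set.Ioi 0) := by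
  refine (integrableOn_rpow_mul_exp (p := a.re - 1) (by linarith) hr).mono'
    (aestronglyMeasurable_cpow_mul_exp a r) ?_
  refine (ae_restrict_iff' measurableSet_Ioi).2 (Filter.Eventually.of_forall fun t ht => ?_)
  exact (norm_cpow_mul_exp ht).le

/-- Differentiation under the integral: where `Re r > Re r₀ / 2`, the derivative of the integrand is
dominated by `t^(Re a) e^(-t Re r₀ / 2)`. -/
theorem differentiableAt_integral_cpow_mul_exp {a r₀ : ℂ} (ha : 0 < a.re) (hr : 0 < r₀.re) :
    DifferentiableAt ℂ
      (fun r : ℂ => ∫ t : ℝ in Set.Ioi 0, (t : ℂ) ^ (a - 1) * Complex.exp (-(r * t))) r₀ := by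
  have hs : {r : ℂ | r₀.re / 2 < r.re} ∈ nhds r₀ :=
    (isOpen_lt continuous_const Complex.continuous_re).mem_nhds (by simpa using by linarith)
  refine (hasDerivAt_integral_of_dominated_loc_of_deriv_le (μ := volume.restrict (Set.Ioi 0))
    (F := fun (r : ℂ) (t : ℝ) => (t : ℂ) ^ (a - 1) * Complex.exp (-(r * t)))
    (F' := fun (r : ℂ) (t : ℝ) => -(t : ℂ) * ((t : ℂ) ^ (a - 1) * Complex.exp (-(r * t))))
    (bound := fun t : ℝ => t ^ a.re * Real.exp (-(r₀.re / 2 * t))) hs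
    (Filter.Eventually.of_forall fun r => aestronglyMeasurable_cpow_mul_exp a r)
    (integrableOn_cpow_mul_exp ha hr) ?_ ?_
    (integrableOn_rpow_mul_exp (by linarith) (by linarith)) ?_).2.differentiableAt
  · exact (by fun_prop : Continuous fun t : ℝ => -(t : ℂ)).aestronglyMeasurable.mul
      (aestronglyMeasurable_cpow_mul_exp a r₀)
  · refine (ae_restrict_iff' measurableSet_Ioi).2 (Filter.Eventually.of_forall fun t ht r hrs => ?_)
    have ht' : (0 : ℝ) < t := ht
    rw [norm_mul, norm_cpow_mul_exp ht', norm_neg, Complex.norm_real, Real.norm_of_nonneg ht'.le,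
      ← mul_assoc, ← Real.rpow_one_add' ht'.le (by simpa using ha.ne')]
    rw [show 1 + (a.re - 1) = a.re by ring]
    refine mul_le_mul_of_nonneg_left (Real.exp_le_exp.2 ?_) (by positivity)
    have : r₀.re / 2 < r.re := hrs
    nlinarith
  · refine Filter.Eventually.of_forall fun t r _ => ?_
    have h1 : HasDerivAt (fun r : ℂ => -(r * t)) (-(t : ℂ)) r :=
      ((hasDerivAt_mul_const (t : ℂ)).neg)
    have h2 := (h1.cexp).const_mul ((t : ℂ) ^ (a - 1))
    exact h2.congr_deriv (by ring)

/-- Both sides are analytic in `r` on the right half-plane and agree with Euler's integral for real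
`r > 0`; the identity theorem does the rest. -/
theorem integral_cpow_mul_exp {a r : ℂ} (ha : 0 < a.re) (hr : 0 < r.re) :
    ∫ t : ℝ in Set.Ioi 0, (t : ℂ) ^ (a - 1) * Complex.exp (-(r * t)) =
      r ^ (-a) * Complex.Gamma a := by
  have hU : IsOpen {r : ℂ | 0 < r.re} := isOpen_lt continuous_const Complex.continuous_re
  have hpre : IsPreconnected {r : ℂ | 0 < r.re} :=
    (convex_halfSpace_re_gt 0).isPreconnected
  have hf : AnalyticOnNhd ℂ
      (fun r : ℂ => ∫ t : ℝ in Set.Ioi 0, (t : ℂ) ^ (a - 1) * Complex.exp (-(r * t)))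
      {r : ℂ | 0 < r.re} :=
    DifferentiableOn.analyticOnNhd (fun r hr =>
      (differentiableAt_integral_cpow_mul_exp ha hr).differentiableWithinAt) hU
  have hg : AnalyticOnNhd ℂ (fun r : ℂ => r ^ (-a) * Complex.Gamma a) {r : ℂ | 0 < r.re} := by
    refine DifferentiableOn.analyticOnNhd (fun r hr => ?_) hU
    have : r ∈ Complex.slitPlane := Or.inl hr
    exact ((differentiableAt_id.cpow_const this).mul_const _).differentiableWithinAt
  refine hf.eqOn_of_preconnected_of_frequently_eq hg hpre (z₀ := 1) (by simp) ?_ hr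
  -- Real points accumulate at `1`, which is all that the identity theorem needs.
  have h1 : ∃ᶠ x : ℝ in nhdsWithin 1 {1}ᶜ, 0 < x :=
    ((lt_mem_nhds (zero_lt_one' ℝ)).filter_mono nhdsWithin_le_nhds).frequently
  have ht : Filter.Tendsto (fun x : ℝ => (x : ℂ)) (nhdsWithin 1 {1}ᶜ) (nhdsWithin 1 {1}ᶜ) := by
    refine tendsto_nhdsWithin_iff.2 ⟨?_, ?_⟩
    · exact (Complex.continuous_ofReal.tendsto' 1 1 (by simp)).mono_left nhdsWithin_le_nhds
    · filter_upwards [self_mem_nhdsWithin] with x hx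
      simpa using hx
  refine ht.frequently (h1.mono fun x hx => ?_)
  rw [Complex.integral_cpow_mul_exp_neg_mul_Ioi ha hx, one_div, Complex.inv_cpow, Complex.cpow_neg]
  rw [Complex.arg_ofReal_of_nonneg hx.le]
  exact Real.pi_pos.ne

/-! ### The Fourier transform of a power along a horizontal line -/

/-- The function `t ^ (s - 1) exp(-2 π c t)` on `t > 0`, extended by zero. -/
def powExp (s : ℂ) (c : ℝ) : ℝ → ℂ :=
  (Set.Ioi 0).indicator fun t : ℝ => (t : ℂ) ^ (s - 1) * Complex.exp (-((2 * Real.pi * c : ℂ) * t))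

/-- The Fourier transform at `x` is the Laplace transform of `t^(s-1)` at `2π(c + i x)`. -/
theorem fourier_powExp {s : ℂ} {c : ℝ} (hs : 0 < s.re) (hc : 0 < c) (x : ℝ) :
    FourierTransform.fourier (powExp s c) x =
      (2 * Real.pi * (c + x * Complex.I)) ^ (-s) * Complex.Gamma s := by
  rw [Real.fourier_eq', ← integral_cpow_mul_exp hs
    (by simpa using by positivity : 0 < (2 * Real.pi * (c + x * Complex.I) : ℂ).re),
    ← integral_indicator measurableSet_Ioi]
  congr 1
  ext t
  by_cases ht : t ∈ Set.Ioi (0 : ℝ)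
  · simp only [powExp, Set.indicator_of_mem ht, smul_eq_mul]
    rw [mul_left_comm, ← Complex.exp_add]
    congr 2
    simp
    ring
  · simp [powExp, Set.indicator_of_notMem ht]

/-- Here `c + i x = -i (-x + i c)`, and the argument of `-x + i c` lies in `[0, π]`. Subtracting
`π/2` keeps it in the principal range, so the logarithms add. This is the origin of the factor
`e^(-sπi/2)`. -/
theorem mul_cpow_quarter_turn {c x : ℝ} (hc : 0 < c) (s : ℂ) :
    (2 * Real.pi * (c + x * Complex.I) : ℂ) ^ (-s) =
      (2 * Real.pi : ℂ) ^ (-s) * Complex.exp (s * Complex.I * Real.pi / 2) *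
        ((-x : ℝ) + c * Complex.I : ℂ) ^ (-s) := by
  have hw : ((-x : ℝ) + c * Complex.I : ℂ) ≠ 0 := by
    intro h
    have := congrArg Complex.im h
    simp at this
    exact hc.ne' this
  have hpi : (2 * Real.pi : ℂ) ≠ 0 := by exact_mod_cast Real.two_pi_pos.ne'
  have h3 : (2 * Real.pi * (c + x * Complex.I) : ℂ) =
      ((2 * Real.pi : ℝ) : ℂ) * ((-Complex.I) * ((-x : ℝ) + c * Complex.I)) := by
    push_cast
    linear_combination (2 * Real.pi * c : ℂ) * Complex.I_mul_I
  have harg : 0 ≤ Complex.arg ((-x : ℝ) + c * Complex.I : ℂ) :=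
    Complex.arg_nonneg_iff.2 (by simpa using hc.le)
  have hI : -Complex.I ≠ 0 := neg_ne_zero.2 Complex.I_ne_zero
  have hlog : Complex.log (2 * Real.pi * (c + x * Complex.I) : ℂ) =
      Complex.log (2 * Real.pi : ℂ) + -(Real.pi / 2) * Complex.I +
        Complex.log ((-x : ℝ) + c * Complex.I : ℂ) := by
    rw [h3, Complex.log_ofReal_mul Real.two_pi_pos (mul_ne_zero hI hw),
      (Complex.log_mul_eq_add_log_iff hI hw).2, Complex.log_neg_I, Complex.ofReal_log (by positivity)]
    · push_cast
      ring
    · rw [Complex.arg_neg_I]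
      constructor
      · linarith [Real.pi_pos]
      · linarith [Real.pi_pos, Complex.arg_le_pi ((-x : ℝ) + c * Complex.I : ℂ)]
  have h0 : (2 * Real.pi * (c + x * Complex.I) : ℂ) ≠ 0 := by
    rw [h3]
    exact mul_ne_zero (by exact_mod_cast Real.two_pi_pos.ne') (mul_ne_zero hI hw)
  rw [Complex.cpow_def_of_ne_zero h0, Complex.cpow_def_of_ne_zero hpi,
    Complex.cpow_def_of_ne_zero hw, hlog, ← Complex.exp_add, ← Complex.exp_add]
  congr 1
  ring

/-- The principal argument is at most `π` in absolute value, so the imaginary part of `s` costs only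
a constant. -/
theorem norm_cpow_neg_le {w : ℂ} (hw : 0 < w.im) (s : ℂ) :
    ‖w ^ (-s)‖ ≤ Real.exp (Real.pi * |s.im|) * ‖w‖ ^ (-s.re) := by
  have hw0 : w ≠ 0 := by rintro rfl; simp at hw
  rw [Complex.norm_cpow_of_ne_zero hw0, Complex.neg_re, Complex.neg_im, div_eq_mul_inv,
    ← Real.exp_neg, mul_comm]
  refine mul_le_mul_of_nonneg_right (Real.exp_le_exp.2 ?_) (by positivity)
  have h1 := Complex.abs_arg_le_pi w
  calc -(w.arg * -s.im) = w.arg * s.im := by ring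
    _ ≤ |w.arg * s.im| := le_abs_self _
    _ = |w.arg| * |s.im| := abs_mul _ _
    _ ≤ _ := mul_le_mul_of_nonneg_right h1 (abs_nonneg _)

theorem continuous_cpow_horizontal (s : ℂ) {c : ℝ} (hc : 0 < c) :
    Continuous fun x : ℝ => ((x : ℂ) + c * Complex.I) ^ (-s) := by
  refine continuous_iff_continuousAt.2 fun x => ?_
  refine ContinuousAt.cpow (by fun_prop) continuousAt_const (Or.inr ?_)
  simpa using hc.ne'

theorem integrable_cpow_horizontal {s : ℂ} {c : ℝ} (hs : 1 < s.re) (hc : 0 < c) :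
    Integrable fun x : ℝ => ((x : ℂ) + c * Complex.I) ^ (-s) := by
  refine ((integrable_norm_rpow hs hc).const_mul _).mono'
    (continuous_cpow_horizontal s hc).aestronglyMeasurable
    (Filter.Eventually.of_forall fun x => norm_cpow_neg_le (by simpa using hc) s)

/-- Fourier inversion for `powExp` at `m`: its transform is a constant times the reflected power,
integrable because `Re s > 1`, and `powExp` is continuous at `m` because `m > 0`. -/
theorem integral_cpow_horizontal {s : ℂ} {c m : ℝ} (hs : 1 < s.re) (hc : 0 < c) (hm : 0 < m) :
    ∫ x : ℝ, ((x : ℂ) + c * Complex.I) ^ (-s) *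
        Complex.exp (-(2 * Real.pi * Complex.I * m * x)) =
      (2 * Real.pi : ℂ) ^ s * Complex.exp (-(s * Complex.I * Real.pi / 2)) / Complex.Gamma s *
        (m : ℂ) ^ (s - 1) * Complex.exp (-(2 * Real.pi * m * c)) := by
  have hs0 : 0 < s.re := by linarith
  have hF : FourierTransform.fourier (powExp s c) = fun x : ℝ =>
      (2 * Real.pi : ℂ) ^ (-s) * Complex.exp (s * Complex.I * Real.pi / 2) * Complex.Gamma s *
        ((-x : ℝ) + c * Complex.I : ℂ) ^ (-s) := by
    ext x
    rw [fourier_powExp hs0 hc, mul_cpow_quarter_turn hc]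
    ring
  have hint : Integrable (powExp s c) := by
    refine (integrable_indicator_iff measurableSet_Ioi).2 (integrableOn_cpow_mul_exp hs0 ?_)
    simpa using by positivity
  have hintF : Integrable (FourierTransform.fourier (powExp s c)) := by
    rw [hF]
    exact ((integrable_cpow_horizontal hs hc).comp_neg).const_mul _
  have hcont : ContinuousAt (powExp s c) m := by
    have h : (fun t : ℝ => (t : ℂ) ^ (s - 1) *
        Complex.exp (-((2 * Real.pi * c : ℂ) * t))) =ᶠ[nhds m] powExp s c := by
      filter_upwards [lt_mem_nhds hm] with t ht
      rw [powExp, Set.indicator_of_mem (show t ∈ Set.Ioi (0 : ℝ) from ht)]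
    refine ContinuousAt.congr (ContinuousAt.mul ?_ (by fun_prop)) h
    exact Complex.continuousAt_ofReal_cpow_const _ _ (Or.inr hm.ne')
  have hinv := hint.fourierInv_fourier_eq hintF hcont
  rw [Real.fourierInv_eq', hF] at hinv
  have hval : powExp s c m = (m : ℂ) ^ (s - 1) * Complex.exp (-(2 * Real.pi * m * c)) := by
    rw [powExp, Set.indicator_of_mem (show m ∈ Set.Ioi (0 : ℝ) from hm)]
    congr 2
    ring
  have hneg := integral_neg_eq_self (fun x : ℝ => ((x : ℂ) + c * Complex.I) ^ (-s) *
        Complex.exp (-(2 * Real.pi * Complex.I * m * x))) volume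
  have hmul : ∀ v : ℝ, Complex.exp (↑(2 * Real.pi * inner ℝ v m) * Complex.I) •
      ((2 * Real.pi : ℂ) ^ (-s) * Complex.exp (s * Complex.I * Real.pi / 2) * Complex.Gamma s *
        ((-v : ℝ) + c * Complex.I : ℂ) ^ (-s)) =
      ((2 * Real.pi : ℂ) ^ (-s) * Complex.exp (s * Complex.I * Real.pi / 2) * Complex.Gamma s) *
        ((((-v : ℝ) : ℂ) + c * Complex.I) ^ (-s) *
        Complex.exp (-(2 * Real.pi * Complex.I * m * (-v : ℝ)))) := by
    intro v
    rw [smul_eq_mul, show (↑(2 * Real.pi * inner ℝ v m) * Complex.I : ℂ) =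
      -(2 * Real.pi * Complex.I * m * (-v : ℝ)) by simp; ring]
    ring
  rw [integral_congr_ae (Filter.Eventually.of_forall hmul), integral_const_mul, hneg, hval] at hinv
  have hpi : (2 * Real.pi : ℂ) ≠ 0 := by exact_mod_cast Real.two_pi_pos.ne'
  have hG := Complex.Gamma_ne_zero_of_re_pos hs0
  have hpow : (2 * Real.pi : ℂ) ^ s ≠ 0 := by simp [Complex.cpow_eq_zero_iff, hpi]
  generalize (∫ x : ℝ, ((x : ℂ) + c * Complex.I) ^ (-s) *
        Complex.exp (-(2 * Real.pi * Complex.I * m * x))) = J at hinv ⊢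
  rw [mul_assoc _ ((m : ℂ) ^ (s - 1)), ← hinv, Complex.cpow_neg, Complex.exp_neg]
  field_simp

/-! ### The unfolded integral -/

theorem ae_stripMeasure_pos : ∀ᵐ p ∂stripMeasure, 0 < p.2 := by
  have h : stripMeasure = (volume : Measure (ℝ × ℝ)).restrict (Set.univ ×ˢ Set.Ioi (0 : ℝ)) := by
    rw [stripMeasure, Measure.volume_eq_prod, ← Measure.prod_restrict, Measure.restrict_univ]
  rw [h]
  filter_upwards [ae_restrict_mem (MeasurableSet.univ.prod measurableSet_Ioi)] with p hp
  exact hp.2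

theorem coe_ofComplex_coord {x y : ℝ} (hy : 0 < y) :
    ((UpperHalfPlane.ofComplex ((x : ℂ) + y * Complex.I) : ℍ) : ℂ) = (x : ℂ) + y * Complex.I := by
  rw [UpperHalfPlane.ofComplex_apply_of_im_pos (by simpa using hy)]

theorem im_ofComplex_coord {x y : ℝ} (hy : 0 < y) :
    (UpperHalfPlane.ofComplex ((x : ℂ) + y * Complex.I) : ℍ).im = y := by
  rw [← UpperHalfPlane.coe_im, coe_ofComplex_coord hy]
  simp

theorem sub_conj_coord (x y : ℝ) (τ : ℂ) :
    (x : ℂ) + y * Complex.I - conj τ =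
      ((x - τ.re : ℝ) : ℂ) + ((y + τ.im : ℝ) : ℂ) * Complex.I := by
  apply Complex.ext <;> simp

/-- For `τ` in the closed upper half-plane, the base of the complex power stays off the branch cut
and away from `0`. -/
theorem im_sub_conj_pos {τ : ℂ} (hτ : 0 ≤ τ.im) (z : ℍ) : 0 < ((z : ℂ) - conj τ).im := by
  have := z.im_pos
  simp
  linarith

/-- The majorant `|z - conj τ| ^ (-r) y ^ p exp(-π y)`. -/
def majorant (τ : ℂ) (r p : ℝ) (z : ℍ) : ℝ :=
  ‖(z : ℂ) - conj τ‖ ^ (-r) * z.im ^ p * Real.exp (-(Real.pi * z.im))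

theorem continuous_majorant {τ : ℂ} (hτ : 0 ≤ τ.im) (r p : ℝ) :
    Continuous (majorant τ r p) := by
  unfold majorant
  refine ((Continuous.rpow_const ?_ fun z => Or.inl ?_).mul
    (UpperHalfPlane.continuous_im.rpow_const fun z => Or.inl z.im_pos.ne')).mul ?_
  · exact (UpperHalfPlane.continuous_coe.sub continuous_const).norm
  · intro h
    have h2 := im_sub_conj_pos hτ z
    rw [norm_eq_zero.1 h] at h2
    simp at h2
  · have := UpperHalfPlane.continuous_im
    fun_prop

/-- The `x`-integral is a constant times `(y + Im τ)^(1-r) ≤ y^(1-r)`. What remains, `y^(p-1-r)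
e^(-πy)`, is integrable at `0` because `p > r`, even for real `τ`. -/
theorem integrable_majorant {τ : ℂ} (hτ : 0 ≤ τ.im) {r p : ℝ} (hr : 1 < r) (hp : r < p) :
    Integrable (majorant τ r p) := by
  rw [integrable_iff_coord]
  set G : ℝ × ℝ → ℝ := fun q => (q.2 ^ 2)⁻¹ • majorant τ r p
    (UpperHalfPlane.ofComplex ((q.1 : ℂ) + q.2 * Complex.I))
  have hG : ∀ x y : ℝ, 0 < y → G (x, y) = ‖((x - τ.re : ℝ) : ℂ) + ((y + τ.im : ℝ) : ℂ) *
      Complex.I‖ ^ (-r) * (y ^ (p - 2) * Real.exp (-(Real.pi * y))) := by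
    intro x y hy
    simp only [G, majorant, smul_eq_mul]
    rw [coe_ofComplex_coord hy, im_ofComplex_coord hy, sub_conj_coord, Real.rpow_sub hy,
      Real.rpow_two]
    ring
  have hmeas : AEStronglyMeasurable G stripMeasure := by
    have h1 : AEStronglyMeasurable (fun q : ℝ × ℝ => ‖((q.1 - τ.re : ℝ) : ℂ) +
        ((q.2 + τ.im : ℝ) : ℂ) * Complex.I‖ ^ (-r) *
        (q.2 ^ (p - 2) * Real.exp (-(Real.pi * q.2)))) stripMeasure := by
      refine Measurable.aestronglyMeasurable ?_
      fun_prop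
    refine h1.congr ?_
    filter_upwards [ae_stripMeasure_pos] with q hq
    exact (hG q.1 q.2 hq).symm
  refine (integrable_prod_iff' hmeas).2 ⟨?_, ?_⟩
  · filter_upwards [ae_restrict_mem measurableSet_Ioi] with y hy
    have hy' : (0 : ℝ) < y := hy
    simp_rw [hG _ y hy']
    exact ((integrable_norm_rpow hr (add_pos_of_pos_of_nonneg hy' hτ)).comp_sub_right τ.re).mul_const _
  · set C := ∫ x : ℝ, ‖(x : ℂ) + Complex.I‖ ^ (-r) with hC
    have hC0 : 0 ≤ C := integral_nonneg fun x => by positivity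
    have hbase := (integrableOn_rpow_mul_exp (p := p - 1 - r) (by linarith) Real.pi_pos).const_mul C
    refine hbase.mono' ?_ ?_
    · exact hmeas.norm.prod_swap.integral_prod_right'
    · filter_upwards [ae_restrict_mem measurableSet_Ioi] with y hy
      have hy' : (0 : ℝ) < y := hy
      rw [Real.norm_of_nonneg (integral_nonneg fun x => norm_nonneg _)]
      have h1 : ∀ x : ℝ, ‖G (x, y)‖ = ‖((x - τ.re : ℝ) : ℂ) + ((y + τ.im : ℝ) : ℂ) *
          Complex.I‖ ^ (-r) * (y ^ (p - 2) * Real.exp (-(Real.pi * y))) := by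
        intro x
        rw [hG x y hy', Real.norm_of_nonneg (by positivity)]
      simp_rw [h1]
      rw [integral_mul_const, integral_sub_right_eq_self (fun x : ℝ =>
        ‖(x : ℂ) + ((y + τ.im : ℝ) : ℂ) * Complex.I‖ ^ (-r)) τ.re,
        integral_norm_rpow r (add_pos_of_pos_of_nonneg hy' hτ), ← hC]
      have h2 : (y + τ.im) ^ (1 - r) ≤ y ^ (1 - r) :=
        Real.rpow_le_rpow_of_nonpos hy' (by linarith) (by linarith)
      calc (y + τ.im) ^ (1 - r) * C * (y ^ (p - 2) * Real.exp (-(Real.pi * y)))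
          ≤ y ^ (1 - r) * C * (y ^ (p - 2) * Real.exp (-(Real.pi * y))) := by gcongr
        _ = C * ((y ^ (1 - r) * y ^ (p - 2)) * Real.exp (-(Real.pi * y))) := by ring
        _ = _ := by
          rw [← Real.rpow_add hy', show 1 - r + (p - 2) = p - 1 - r by ring]

/-- The integrand of the unfolded Petersson product. -/
def unfolded (τ s : ℂ) (k : ℤ) (φ : ℍ → ℂ) (z : ℍ) : ℂ :=
  ((z : ℂ) - conj τ) ^ (-s) * conj (φ z) * (z.im : ℂ) ^ k

theorem continuous_sub_cpow {τ : ℂ} (hτ : 0 ≤ τ.im) (s : ℂ) :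
    Continuous fun z : ℍ => ((z : ℂ) - conj τ) ^ (-s) := by
  refine continuous_iff_continuousAt.2 fun z => ?_
  refine ContinuousAt.cpow ?_ continuousAt_const (Or.inr (im_sub_conj_pos hτ z).ne')
  exact (UpperHalfPlane.continuous_coe.sub continuous_const).continuousAt

theorem continuous_unfolded {τ : ℂ} (hτ : 0 ≤ τ.im) (s : ℂ) (k : ℤ) {φ : ℍ → ℂ}
    (hφ : Continuous φ) : Continuous (unfolded τ s k φ) := by
  unfold unfolded
  refine ((continuous_sub_cpow hτ s).mul (Complex.continuous_conj.comp hφ)).mul ?_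
  refine Continuous.zpow₀ (Complex.continuous_ofReal.comp UpperHalfPlane.continuous_im) k
    fun z => Or.inl ?_
  exact Complex.ofReal_ne_zero.2 z.im_pos.ne'

theorem integrable_unfolded {τ s : ℂ} {k : ℤ} {φ : ℍ → ℂ} (hτ : 0 ≤ τ.im) (hs : 1 < s.re)
    (hsk : s.re < (k : ℝ) / 2) (hφ : Continuous φ) {C : ℝ}
    (hC : ∀ z : ℍ, ‖φ z‖ ≤ C * (z.im ^ (-((k : ℝ) / 2)) * Real.exp (-(Real.pi * z.im)))) :
    Integrable (unfolded τ s k φ) := by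
  refine ((integrable_majorant hτ hs hsk).const_mul (Real.exp (Real.pi * |s.im|) * C)).mono'
    (continuous_unfolded hτ s k hφ).aestronglyMeasurable (Filter.Eventually.of_forall fun z => ?_)
  rw [unfolded, norm_mul, norm_mul, RCLike.norm_conj, norm_zpow, Complex.norm_real,
    Real.norm_of_nonneg z.im_pos.le, majorant]
  have h1 := norm_cpow_neg_le (im_sub_conj_pos hτ z) s
  have hy := z.im_pos
  calc _ ≤ (Real.exp (Real.pi * |s.im|) * ‖(z : ℂ) - conj τ‖ ^ (-s.re)) *
        (C * (z.im ^ (-((k : ℝ) / 2)) * Real.exp (-(Real.pi * z.im)))) * z.im ^ k := by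
        gcongr
        exact hC z
    _ = Real.exp (Real.pi * |s.im|) * C * (‖(z : ℂ) - conj τ‖ ^ (-s.re) *
        (z.im ^ (-((k : ℝ) / 2)) * z.im ^ k) * Real.exp (-(Real.pi * z.im))) := by ring
    _ = _ := by
      rw [← Real.rpow_intCast z.im k, ← Real.rpow_add hy]
      congr 4
      ring

/-! ### Evaluation of the unfolded integral -/

/-- Shift `x` by `Re τ` and take `c = y + Im τ`. The decay `e^(-2πmy)` of the conjugate exponential
and `e^(-2πm(y + Im τ))` from the Fourier integral combine to `e^(-4πmy)` and the twist at `-conj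
τ`. -/
theorem integral_horizontal_term {τ s : ℂ} (hτ : 0 ≤ τ.im) (hs : 1 < s.re) {y : ℝ} (hy : 0 < y)
    {m : ℕ} (hm : 0 < m) :
    ∫ x : ℝ, ((x : ℂ) + y * Complex.I - conj τ) ^ (-s) *
        conj (Complex.exp (2 * Real.pi * Complex.I * m * ((x : ℂ) + y * Complex.I))) =
      (2 * Real.pi : ℂ) ^ s * Complex.exp (-(s * Complex.I * Real.pi / 2)) / Complex.Gamma s *
        (m : ℂ) ^ (s - 1) * Complex.exp (2 * Real.pi * Complex.I * m * (-conj τ)) *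
        Complex.exp (-(4 * Real.pi * m * y)) := by
  have h := integral_cpow_horizontal (m := m) hs (add_pos_of_pos_of_nonneg hy hτ)
    (by exact_mod_cast hm)
  have hconj : conj τ = (τ.re : ℂ) - τ.im * Complex.I := by apply Complex.ext <;> simp
  have h1 : ∀ x : ℝ, ((x : ℂ) + y * Complex.I - conj τ) ^ (-s) *
        conj (Complex.exp (2 * Real.pi * Complex.I * m * ((x : ℂ) + y * Complex.I))) =
      (fun x : ℝ => ((x : ℂ) + ((y + τ.im : ℝ) : ℂ) * Complex.I) ^ (-s) *
        Complex.exp (-(2 * Real.pi * Complex.I * (m : ℝ) * x))) (x - τ.re) *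
        Complex.exp (-(2 * Real.pi * Complex.I * m * τ.re) - 2 * Real.pi * m * y) := by
    intro x
    have e : conj (Complex.exp (2 * Real.pi * Complex.I * m * ((x : ℂ) + y * Complex.I))) =
        Complex.exp (-(2 * Real.pi * Complex.I * (m : ℝ) * (x - τ.re : ℝ))) *
        Complex.exp (-(2 * Real.pi * Complex.I * m * τ.re) - 2 * Real.pi * m * y) := by
      rw [← Complex.exp_add, ← Complex.exp_conj]
      congr 1
      simp only [map_mul, map_add, Complex.conj_I, Complex.conj_ofReal, map_ofNat, map_natCast]
      push_cast
      linear_combination (2 * Real.pi * m * y : ℂ) * Complex.I_mul_I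
    simp only
    rw [sub_conj_coord, e]
    ring
  have e2 : Complex.exp (-(2 * Real.pi * m * (y + τ.im : ℝ))) *
      Complex.exp (-(2 * Real.pi * Complex.I * m * τ.re) - 2 * Real.pi * m * y) =
      Complex.exp (2 * Real.pi * Complex.I * m * (-conj τ)) *
        Complex.exp (-(4 * Real.pi * m * y)) := by
    rw [← Complex.exp_add, ← Complex.exp_add, hconj]
    congr 1
    push_cast
    linear_combination (-2 * Real.pi * m * τ.im : ℂ) * Complex.I_mul_I
  rw [integral_congr_ae (Filter.Eventually.of_forall h1), integral_mul_const,
    integral_sub_right_eq_self (fun x : ℝ => ((x : ℂ) + ((y + τ.im : ℝ) : ℂ) * Complex.I) ^ (-s) *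
        Complex.exp (-(2 * Real.pi * Complex.I * (m : ℝ) * x))), h]
  simp only [Complex.ofReal_natCast]
  linear_combination ((2 * Real.pi : ℂ) ^ s * Complex.exp (-(s * Complex.I * Real.pi / 2)) /
    Complex.Gamma s * (m : ℂ) ^ (s - 1)) * e2

theorem integrable_horizontal {τ s : ℂ} (hτ : 0 ≤ τ.im) (hs : 1 < s.re) {y : ℝ} (hy : 0 < y) :
    Integrable fun x : ℝ => ((x : ℂ) + y * Complex.I - conj τ) ^ (-s) := by
  simp_rw [sub_conj_coord]
  exact (integrable_cpow_horizontal hs (add_pos_of_pos_of_nonneg hy hτ)).comp_sub_right τ.re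

/-- The coefficients of the Laplace expansion of the unfolded integral along horizontal lines. -/
def laplaceCoeff (τ s : ℂ) (a : ℕ → ℂ) (m : ℕ) : ℂ :=
  conj (a m) * ((2 * Real.pi : ℂ) ^ s * Complex.exp (-(s * Complex.I * Real.pi / 2)) /
    Complex.Gamma s * (m : ℂ) ^ (s - 1) * Complex.exp (2 * Real.pi * Complex.I * m * (-conj τ)))

theorem norm_exp_two_pi_mul (m : ℕ) (x y : ℝ) :
    ‖Complex.exp (2 * Real.pi * Complex.I * m * ((x : ℂ) + y * Complex.I))‖ =
      Real.exp (-(2 * Real.pi * m * y)) := by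
  rw [Complex.norm_exp]
  congr 1
  simp

/-- At fixed height the expansion of `φ` converges absolutely and uniformly in `x`, so it may be
integrated term by term. Cuspidality `a 0 = 0` disposes of the frequency `m = 0`, where the Fourier
formula is unavailable. -/
theorem integral_horizontal {τ s : ℂ} (hτ : 0 ≤ τ.im) (hs : 1 < s.re) {φ : ℍ → ℂ} {a : ℕ → ℂ}
    (ha0 : a 0 = 0)
    (hφ : ∀ z : ℍ, HasSum (fun m : ℕ => a m * Complex.exp (2 * Real.pi * Complex.I * m * z)) (φ z))
    {y : ℝ} (hy : 0 < y) :
    ∫ x : ℝ, ((x : ℂ) + y * Complex.I - conj τ) ^ (-s) *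
        conj (φ (UpperHalfPlane.ofComplex ((x : ℂ) + y * Complex.I))) =
      ∑' m : ℕ, laplaceCoeff τ s a m * Complex.exp (-(4 * Real.pi * m * y)) := by
  set P : ℝ → ℂ := fun x => ((x : ℂ) + y * Complex.I - conj τ) ^ (-s)
  have hP : Integrable P := integrable_horizontal hτ hs hy
  set T : ℕ → ℝ → ℂ := fun m x => conj (a m) * (P x *
    conj (Complex.exp (2 * Real.pi * Complex.I * m * ((x : ℂ) + y * Complex.I))))
  have hnorm : ∀ m x, ‖T m x‖ = ‖a m‖ * Real.exp (-(2 * Real.pi * m * y)) * ‖P x‖ := by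
    intro m x
    simp only [T, norm_mul, RCLike.norm_conj, norm_exp_two_pi_mul]
    ring
  have hT : ∀ m, Integrable (T m) := by
    intro m
    refine (hP.norm.const_mul (‖a m‖ * Real.exp (-(2 * Real.pi * m * y)))).mono' ?_
      (Filter.Eventually.of_forall fun x => (hnorm m x).le)
    refine (hP.aestronglyMeasurable.mul ?_).const_mul _
    refine Continuous.aestronglyMeasurable ?_
    exact Complex.continuous_conj.comp (by fun_prop)
  have hsum : Summable fun m : ℕ => ‖a m‖ * Real.exp (-(2 * Real.pi * m * y)) := by
    have h := (hφ (UpperHalfPlane.ofComplex (((0 : ℝ) : ℂ) + y * Complex.I))).summable.norm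
    refine h.congr fun m => ?_
    rw [coe_ofComplex_coord hy, norm_mul, norm_exp_two_pi_mul]
  have h := hasSum_integral_of_summable_integral_norm hT (by
    simp_rw [hnorm, integral_const_mul]
    exact hsum.mul_right _)
  have h1 : ∀ x : ℝ, P x * conj (φ (UpperHalfPlane.ofComplex ((x : ℂ) + y * Complex.I))) =
      ∑' m, T m x := by
    intro x
    have h2 := hφ (UpperHalfPlane.ofComplex ((x : ℂ) + y * Complex.I))
    rw [coe_ofComplex_coord hy] at h2
    have h3 := ((Complex.hasSum_conj'.2 h2).mul_left (P x)).tsum_eq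
    rw [← h3]
    refine tsum_congr fun m => ?_
    simp only [T, map_mul]
    ring
  rw [integral_congr_ae (Filter.Eventually.of_forall h1), ← h.tsum_eq]
  refine tsum_congr fun m => ?_
  simp only [T, integral_const_mul, laplaceCoeff]
  rcases Nat.eq_zero_or_pos m with rfl | hm
  · simp [ha0]
  · simp only [P]
    rw [integral_horizontal_term hτ hs hy hm]
    ring

theorem norm_exp_neg_conj_le {τ : ℂ} (hτ : 0 ≤ τ.im) (m : ℕ) :
    ‖Complex.exp (2 * Real.pi * Complex.I * m * (-conj τ))‖ ≤ 1 := by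
  rw [Complex.norm_exp, Real.exp_le_one_iff]
  simp
  positivity

theorem summable_norm_mul_rpow {a : ℕ → ℂ} {C q e : ℝ}
    (ha : ∀ m : ℕ, 0 < m → ‖a m‖ ≤ C * (m : ℝ) ^ q) (he : q + e < -1) (ha0 : a 0 = 0) :
    Summable fun m : ℕ => ‖a m‖ * (m : ℝ) ^ e := by
  refine Summable.of_nonneg_of_le (fun m => by positivity) (fun m => ?_)
    ((Real.summable_nat_rpow.2 he).mul_left C)
  rcases Nat.eq_zero_or_pos m with rfl | hm
  · have : (0 : ℝ) ^ (q + e) = 0 := Real.zero_rpow (by linarith)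
    simp [ha0, this]
  · have hm' : (0 : ℝ) < m := by exact_mod_cast hm
    rw [Real.rpow_add hm', ← mul_assoc]
    exact mul_le_mul_of_nonneg_right (ha m hm) (by positivity)

theorem norm_laplaceCoeff_le {τ s : ℂ} (hτ : 0 ≤ τ.im) {a : ℕ → ℂ} (ha0 : a 0 = 0) (m : ℕ) :
    ‖laplaceCoeff τ s a m‖ ≤ ‖(2 * Real.pi : ℂ) ^ s * Complex.exp (-(s * Complex.I * Real.pi / 2)) /
      Complex.Gamma s‖ * (‖a m‖ * (m : ℝ) ^ (s.re - 1)) := by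
  rcases Nat.eq_zero_or_pos m with rfl | hm
  · simp [laplaceCoeff, ha0]
  · have hm' : (0 : ℝ) < m := by exact_mod_cast hm
    have h1 : ‖(m : ℂ) ^ (s - 1)‖ = (m : ℝ) ^ (s.re - 1) := by
      rw [← Complex.ofReal_natCast, Complex.norm_cpow_eq_rpow_re_of_pos hm']
      simp
    rw [laplaceCoeff, norm_mul, norm_mul, norm_mul _ ((m : ℂ) ^ (s - 1)), h1, RCLike.norm_conj]
    have h2 := norm_exp_neg_conj_le hτ m
    calc _ ≤ ‖a m‖ * (‖(2 * Real.pi : ℂ) ^ s * Complex.exp (-(s * Complex.I * Real.pi / 2)) /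
      Complex.Gamma s‖ * (m : ℝ) ^ (s.re - 1) * 1) := by gcongr
      _ = _ := by ring

theorem integral_laplace_term {k : ℤ} (hk : 1 < k) {m : ℕ} (hm : 0 < m) :
    ∫ y : ℝ in Set.Ioi 0, (y : ℂ) ^ (k - 2) * Complex.exp (-(4 * Real.pi * m * y)) =
      (4 * Real.pi * m : ℂ) ^ (-((k : ℂ) - 1)) * Complex.Gamma (k - 1) := by
  have hk' : (1 : ℝ) < k := by exact_mod_cast hk
  have hm' : (0 : ℝ) < m := by exact_mod_cast hm
  rw [← integral_cpow_mul_exp (a := (k : ℂ) - 1) (r := 4 * Real.pi * m) (by simpa using hk')]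
  · refine setIntegral_congr_fun measurableSet_Ioi fun y hy => ?_
    rw [show (k : ℂ) - 1 - 1 = ((k - 2 : ℤ) : ℂ) by push_cast; ring, Complex.cpow_intCast]
  · have : (4 * Real.pi * m : ℂ) = ((4 * Real.pi * m : ℝ) : ℂ) := by push_cast; ring
    rw [this, Complex.ofReal_re]
    positivity

theorem integral_laplace_term_real {k : ℤ} (hk : 1 < k) {m : ℕ} (hm : 0 < m) :
    IntegrableOn (fun y : ℝ => y ^ (k - 2) * Real.exp (-(4 * Real.pi * m * y))) (Set.Ioi 0) ∧
    ∫ y : ℝ in Set.Ioi 0, y ^ (k - 2) * Real.exp (-(4 * Real.pi * m * y)) =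
      (4 * Real.pi) ^ (1 - (k : ℝ)) * Real.Gamma (k - 1) * (m : ℝ) ^ (1 - (k : ℝ)) := by
  have hk' : (1 : ℝ) < k := by exact_mod_cast hk
  have hm' : (0 : ℝ) < m := by exact_mod_cast hm
  have h := Real.integral_rpow_mul_exp_neg_mul_Ioi (a := (k : ℝ) - 1) (r := 4 * Real.pi * m)
    (by linarith) (by positivity)
  have h2 := integrableOn_rpow_mul_exp (p := ((k - 2 : ℤ) : ℝ)) (b := 4 * Real.pi * m)
    (by push_cast; linarith) (by positivity)
  have h3 : (k : ℝ) - 1 - 1 = ((k - 2 : ℤ) : ℝ) := by push_cast; ring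
  rw [h3] at h
  simp only [Real.rpow_intCast] at h h2
  refine ⟨h2, h.trans ?_⟩
  rw [one_div, Real.inv_rpow (by positivity), ← Real.rpow_neg (by positivity),
    Real.mul_rpow (by positivity) (by positivity), neg_sub]
  ring

/-- Term-by-term integration needs `∑ |a(m)| m^(Re s - k) < ∞`. With Hecke's bound the exponent is
`Re s - k/2`, which is below `-1` because `Re s < k/2 - 1`; the weaker `Re s < k/2` would not
suffice here. -/
theorem integral_laplace {τ s : ℂ} (hτ : 0 ≤ τ.im) {k : ℤ} (hk : 1 < k)
    (hsk : s.re < (k : ℝ) / 2 - 1) {a : ℕ → ℂ} (ha0 : a 0 = 0) {C : ℝ}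
    (ha : ∀ m : ℕ, 0 < m → ‖a m‖ ≤ C * (m : ℝ) ^ ((k : ℝ) / 2)) :
    ∫ y : ℝ in Set.Ioi 0, (y : ℂ) ^ (k - 2) *
        ∑' m : ℕ, laplaceCoeff τ s a m * Complex.exp (-(4 * Real.pi * m * y)) =
      ∑' m : ℕ, laplaceCoeff τ s a m *
        ((4 * Real.pi * m : ℂ) ^ (-((k : ℂ) - 1)) * Complex.Gamma (k - 1)) := by
  set T : ℕ → ℝ → ℂ := fun m y => laplaceCoeff τ s a m *
    ((y : ℂ) ^ (k - 2) * Complex.exp (-(4 * Real.pi * m * y)))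
  have hnorm : ∀ m : ℕ, ∀ y ∈ Set.Ioi (0 : ℝ), ‖T m y‖ = ‖laplaceCoeff τ s a m‖ *
      (y ^ (k - 2) * Real.exp (-(4 * Real.pi * m * y))) := by
    intro m y hy
    have hy' : (0 : ℝ) < y := hy
    simp only [T, norm_mul, norm_zpow, Complex.norm_real, Real.norm_of_nonneg hy'.le,
      Complex.norm_exp]
    congr 3
    simp
  have hL0 : laplaceCoeff τ s a 0 = 0 := by simp [laplaceCoeff, ha0]
  have hmeas : ∀ m, AEStronglyMeasurable (T m) (volume.restrict (Set.Ioi 0)) := by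
    intro m
    refine ContinuousOn.aestronglyMeasurable (fun y hy => ?_) measurableSet_Ioi
    refine ContinuousAt.continuousWithinAt (continuousAt_const.mul (ContinuousAt.mul ?_
      (by fun_prop)))
    exact (Complex.continuous_ofReal.continuousAt).zpow₀ _
      (Or.inl (Complex.ofReal_ne_zero.2 (ne_of_gt hy)))
  have hT : ∀ m, Integrable (T m) (volume.restrict (Set.Ioi 0)) := by
    intro m
    rcases Nat.eq_zero_or_pos m with rfl | hm
    · simp [T, hL0]
    · refine ((integral_laplace_term_real hk hm).1.const_mul ‖laplaceCoeff τ s a m‖).mono'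
        (hmeas m) ?_
      exact (ae_restrict_iff' measurableSet_Ioi).2
        (Filter.Eventually.of_forall fun y hy => (hnorm m y hy).le)
  have hle : ∀ m, ∫ y in Set.Ioi 0, ‖T m y‖ ≤
      (‖(2 * Real.pi : ℂ) ^ s * Complex.exp (-(s * Complex.I * Real.pi / 2)) /
      Complex.Gamma s‖ * ((4 * Real.pi) ^ (1 - (k : ℝ)) * Real.Gamma (k - 1))) *
      (‖a m‖ * (m : ℝ) ^ (s.re - k)) := by
    intro m
    rcases Nat.eq_zero_or_pos m with rfl | hm
    · simp [T, hL0, ha0]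
    · have hm' : (0 : ℝ) < m := by exact_mod_cast hm
      have hk' : (1 : ℝ) < k := by exact_mod_cast hk
      have hG : 0 < Real.Gamma (k - 1) := Real.Gamma_pos_of_pos (by linarith)
      rw [setIntegral_congr_fun measurableSet_Ioi (hnorm m), integral_const_mul,
        (integral_laplace_term_real hk hm).2]
      refine (mul_le_mul_of_nonneg_right (norm_laplaceCoeff_le hτ ha0 m) (by positivity)).trans
        (le_of_eq ?_)
      rw [show s.re - k = (s.re - 1) + (1 - k) by ring, Real.rpow_add hm']
      ring
  have hsum : Summable fun m => ∫ y in Set.Ioi 0, ‖T m y‖ :=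
    Summable.of_nonneg_of_le (fun m => integral_nonneg fun y => norm_nonneg _) hle
      ((summable_norm_mul_rpow ha (by linarith) ha0).mul_left _)
  have h := hasSum_integral_of_summable_integral_norm hT hsum
  have h1 : ∀ y : ℝ, (y : ℂ) ^ (k - 2) *
      ∑' m : ℕ, laplaceCoeff τ s a m * Complex.exp (-(4 * Real.pi * m * y)) = ∑' m, T m y := by
    intro y
    rw [← tsum_mul_left]
    exact tsum_congr fun m => by simp only [T]; ring
  rw [integral_congr_ae (Filter.Eventually.of_forall h1), ← h.tsum_eq]
  refine tsum_congr fun m => ?_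
  simp only [T, integral_const_mul]
  rcases Nat.eq_zero_or_pos m with rfl | hm
  · simp [hL0]
  · rw [integral_laplace_term hk hm]

theorem LSeriesSummable_twist {τ s : ℂ} (hτ : 0 ≤ τ.im) {k : ℤ}
    (hsk : s.re < (k : ℝ) / 2 - 1) {a : ℕ → ℂ} (ha0 : a 0 = 0) {C : ℝ}
    (ha : ∀ m : ℕ, 0 < m → ‖a m‖ ≤ C * (m : ℝ) ^ ((k : ℝ) / 2)) :
    LSeriesSummable (twist (fun m => conj (a m)) (-conj τ)) (k - s) := by
  refine Summable.of_norm_bounded (summable_norm_mul_rpow (e := s.re - k) ha (by linarith) ha0)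
    fun m => ?_
  rcases Nat.eq_zero_or_pos m with rfl | hm
  · simp [ha0]
  · have hm' : (0 : ℝ) < m := by exact_mod_cast hm
    rw [LSeries.term_of_ne_zero hm.ne', twist, norm_div, norm_mul, RCLike.norm_conj,
      ← Complex.ofReal_natCast, Complex.norm_cpow_eq_rpow_re_of_pos hm', div_eq_mul_inv,
      ← Real.rpow_neg hm'.le]
    have h2 := norm_exp_neg_conj_le hτ m
    rw [← Complex.ofReal_natCast] at h2
    calc _ ≤ ‖a m‖ * 1 * (m : ℝ) ^ (-((k : ℂ) - s).re) := by gcongr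
      _ = _ := by simp

/-- Writing `(4πm)^(1-k) = 2^(1-k) (2π)^(1-k) m^(1-k)`, the powers of `2π` split into the
`(2π)^(s-k)` of the completed series and one `2π`, which turns `2^(1-k)` into `2^(2-k) π`. The
`Γ(k-s)` in the denominator cancels the one in the completed series. -/
theorem tsum_laplace {τ s : ℂ} (hs : 1 < s.re) {k : ℤ}
    (hsk : s.re < (k : ℝ) / 2 - 1) {a : ℕ → ℂ} (ha0 : a 0 = 0) :
    ∑' m : ℕ, laplaceCoeff τ s a m *
        ((4 * Real.pi * m : ℂ) ^ (-((k : ℂ) - 1)) * Complex.Gamma (k - 1)) =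
      (2 : ℂ) ^ (2 - k) * Real.pi * Complex.exp (-(s * Complex.I * Real.pi / 2)) *
            (Complex.Gamma (k - 1) / (Complex.Gamma s * Complex.Gamma (k - s))) *
            twistedLStar (fun m => conj (a m)) (k - s) (-conj τ) := by
  have hpi : (Real.pi : ℂ) ≠ 0 := by exact_mod_cast Real.pi_ne_zero
  have h2pi : (2 * Real.pi : ℂ) ≠ 0 := by exact_mod_cast Real.two_pi_pos.ne'
  have hG : Complex.Gamma (k - s) ≠ 0 := by
    refine Complex.Gamma_ne_zero_of_re_pos ?_
    simp
    linarith
  rw [twistedLStar, LSeries, ← mul_assoc, ← tsum_mul_left]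
  refine tsum_congr fun m => ?_
  rcases Nat.eq_zero_or_pos m with rfl | hm
  · simp [laplaceCoeff, ha0]
  have hm' : (0 : ℝ) < m := by exact_mod_cast hm
  have hmc : (m : ℂ) ≠ 0 := by exact_mod_cast hm.ne'
  rw [LSeries.term_of_ne_zero hm.ne', twist, laplaceCoeff]
  have h4 : (4 * Real.pi * m : ℂ) ^ (-((k : ℂ) - 1)) =
      (2 : ℂ) ^ (1 - k) * (2 * Real.pi : ℂ) ^ (1 - k) * (m : ℂ) ^ (1 - k) := by
    rw [show -((k : ℂ) - 1) = ((1 - k : ℤ) : ℂ) by push_cast; ring, Complex.cpow_intCast,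
      ← mul_zpow, ← mul_zpow]
    congr 1
    ring
  have h5 : (2 * Real.pi : ℂ) ^ (-((k : ℂ) - s)) = (2 * Real.pi : ℂ) ^ s *
      (2 * Real.pi : ℂ) ^ (-k) := by
    rw [← Complex.cpow_intCast, ← Complex.cpow_add _ _ h2pi]
    congr 1
    push_cast
    ring
  have h6 : (m : ℂ) ^ ((k : ℂ) - s) = (m : ℂ) ^ k / ((m : ℂ) ^ (s - 1) * m) := by
    rw [Complex.cpow_sub _ 1 hmc, Complex.cpow_one, div_mul_cancel₀ _ hmc,
      Complex.cpow_sub _ _ hmc, Complex.cpow_intCast]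
  have h7 : (m : ℂ) ^ (s - 1) ≠ 0 := by simp [Complex.cpow_eq_zero_iff, hmc]
  rw [h4, h5, h6, zpow_sub₀ two_ne_zero, zpow_sub₀ two_ne_zero, zpow_sub₀ h2pi, zpow_sub₀ hmc,
    zpow_neg]
  have h8 : (m : ℂ) ^ k ≠ 0 := zpow_ne_zero _ hmc
  have h9 : (2 * Real.pi : ℂ) ^ k ≠ 0 := zpow_ne_zero _ h2pi
  field_simp

/-- The value of the unfolded Petersson product. -/
theorem integral_unfolded {τ s : ℂ} (hτ : 0 ≤ τ.im) {k : ℤ} (hs : 1 < s.re)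
    (hsk : s.re < (k : ℝ) / 2 - 1) {φ : ℍ → ℂ} (hφc : Continuous φ) {a : ℕ → ℂ} (ha0 : a 0 = 0)
    (hφ : ∀ z : ℍ, HasSum (fun m : ℕ => a m * Complex.exp (2 * Real.pi * Complex.I * m * z)) (φ z))
    {C : ℝ} (ha : ∀ m : ℕ, 0 < m → ‖a m‖ ≤ C * (m : ℝ) ^ ((k : ℝ) / 2)) {C' : ℝ}
    (hC : ∀ z : ℍ, ‖φ z‖ ≤ C' * (z.im ^ (-((k : ℝ) / 2)) * Real.exp (-(Real.pi * z.im)))) :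
    ∫ z, unfolded τ s k φ z =
      (2 : ℂ) ^ (2 - k) * Real.pi * Complex.exp (-(s * Complex.I * Real.pi / 2)) *
            (Complex.Gamma (k - 1) / (Complex.Gamma s * Complex.Gamma (k - s))) *
            twistedLStar (fun m => conj (a m)) (k - s) (-conj τ) := by
  have hk : 1 < k := by
    have : (1 : ℝ) < k := by linarith
    exact_mod_cast this
  have hint := integrable_unfolded hτ hs (by linarith) hφc hC
  rw [← tsum_laplace hs hsk ha0, ← integral_laplace hτ hk hsk ha0 ha, integral_eq_coord,
    stripMeasure, integral_prod_symm _ ((integrable_iff_coord _).1 hint)]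
  refine setIntegral_congr_fun measurableSet_Ioi fun y hy => ?_
  have hy' : (0 : ℝ) < y := hy
  simp only
  rw [← integral_horizontal hτ hs ha0 hφ hy', ← integral_const_mul]
  refine integral_congr_ae (Filter.Eventually.of_forall fun x => ?_)
  simp only [unfolded]
  rw [coe_ofComplex_coord hy', im_ofComplex_coord hy', zpow_sub₀ (by exact_mod_cast hy'.ne'),
    Complex.real_smul, div_eq_mul_inv, zpow_ofNat, Complex.ofReal_inv, Complex.ofReal_pow]
  ring

/-- The density `y^(-2)` never vanishes. This makes fundamental domains non-null, and null open sets
empty. -/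
instance : (volume : Measure ℍ).IsOpenPosMeasure := by
  have h : ((volume : Measure ℂ).comap UpperHalfPlane.coe).IsOpenPosMeasure :=
    Measure.IsOpenPosMeasure.comap _ UpperHalfPlane.isOpenEmbedding_coe
  rw [UpperHalfPlane.volume_def]
  refine (withDensity_absolutelyContinuous' (measurable_density.coe_nnreal_ennreal).aemeasurable
    (Filter.Eventually.of_forall fun z => ?_)).isOpenPosMeasure
  have : NNReal.mk z.im z.im_pos.le ≠ 0 := fun h => z.im_pos.ne' (congrArg NNReal.toReal h)
  exact_mod_cast pow_ne_zero 2 (one_div_ne_zero this)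

/-! ### Heights of orbits -/

/-- The translation `z ↦ z + t`. -/
def translation (t : ℝ) : SL(2, ℝ) := ⟨!![1, t; 0, 1], by simp [Matrix.det_fin_two]⟩

theorem translation_add (t u : ℝ) : translation (t + u) = translation t * translation u := by
  ext i j
  rw [Matrix.SpecialLinearGroup.coe_mul]
  fin_cases i <;> fin_cases j <;>
    simp [translation, Matrix.mul_apply, Fin.sum_univ_two, add_comm]

theorem translation_zero : translation 0 = 1 := by
  ext i j
  fin_cases i <;> fin_cases j <;> simp [translation]

theorem coe_translation_smul (t : ℝ) (z : ℍ) : ((translation t • z : ℍ) : ℂ) = z + t := by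
  rw [SL_smul_coe]
  simp [translation]

theorem im_translation_smul (t : ℝ) (z : ℍ) : (translation t • z).im = z.im := by
  rw [← UpperHalfPlane.coe_im, coe_translation_smul]
  simp

theorem translation_injective : Function.Injective translation := by
  intro t u h
  have := congrArg (fun g : SL(2, ℝ) => g 0 1) h
  simpa [translation] using this

/-- The distance is `2 arsinh(t / 2y) ≤ t / y`. -/
theorem dist_translation_smul_le {t : ℝ} {z : ℍ} (ht : 0 ≤ t) (htz : t ≤ z.im) :
    dist (translation t • z) z ≤ 1 := by
  have hz := z.im_pos
  rw [UpperHalfPlane.dist_eq, im_translation_smul, coe_translation_smul, Real.sqrt_mul_self hz.le]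
  have h1 : dist ((z : ℂ) + t) z = t := by
    rw [dist_eq_norm, add_sub_cancel_left, Complex.norm_real, Real.norm_of_nonneg ht]
  rw [h1]
  have h2 : t / (2 * z.im) ≤ 1 / 2 := by
    rw [div_le_div_iff₀ (by positivity) two_pos]
    linarith
  have h3 : Real.arsinh (t / (2 * z.im)) ≤ t / (2 * z.im) := by
    rw [← Real.sinh_le_sinh, Real.sinh_arsinh]
    exact Real.self_le_sinh_iff.2 (by positivity)
  linarith

theorem conj_translation_mem {Γ : Subgroup PSL(2, ℝ)} {σ : SL(2, ℝ)}
    (hT : σ * translation 1 * σ⁻¹ ∈ preSL Γ) (n : ℕ) :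
    σ * translation n * σ⁻¹ ∈ preSL Γ := by
  induction n with
  | zero => simp [translation_zero]
  | succ n ih =>
    have : σ * translation (n + 1 : ℕ) * σ⁻¹ =
        (σ * translation n * σ⁻¹) * (σ * translation 1 * σ⁻¹) := by
      push_cast
      rw [translation_add]
      group
    rw [this]
    exact mul_mem ih hT

/-- If `w = σ⁻¹ γ z` is high, all translates `w + n` with `0 ≤ n ≤ Im w` are within distance `1` of
`w`. Carried back by `σ⁻¹ γ`, these translations are distinct elements of the discrete group moving
`z` by at most `1`. Proper discontinuity bounds their number independently of `γ`, and hence `Im w`.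
-/
theorem exists_im_smul_le {Γ : Subgroup PSL(2, ℝ)} (hd : DiscreteTopology (preSL Γ))
    {σ : SL(2, ℝ)} (hT : σ * translation 1 * σ⁻¹ ∈ preSL Γ) (z : ℍ) :
    ∃ A : ℝ, ∀ γ : Γ, (((toPSL σ)⁻¹ * (γ : PSL(2, ℝ))) • z).im ≤ A := by
  have hK : IsCompact (Metric.closedBall z 1) := isCompact_closedBall z 1
  have hfin : Set.Finite {g : preSL Γ | ((fun w : ℍ => g • w) '' Metric.closedBall z 1 ∩
      Metric.closedBall z 1).Nonempty} :=
    ProperlyDiscontinuousSMul.finite_disjoint_inter_image (Γ := preSL Γ) hK hK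
  refine ⟨hfin.toFinset.card, fun γ => ?_⟩
  obtain ⟨⟨g, hg⟩, hgγ⟩ : ∃ g : preSL Γ, toPSL g = γ := by
    obtain ⟨M, hM⟩ := exists_toPSL_eq (γ : PSL(2, ℝ))
    exact ⟨⟨M, by rw [Subgroup.mem_comap, hM]; exact γ.2⟩, hM⟩
  simp only at hgγ
  rw [← hgγ, ← map_inv, ← map_mul, toPSL_smul]
  set w := (σ⁻¹ * g) • z with hw
  have hmem : ∀ n : ℕ, g⁻¹ * (σ * translation n * σ⁻¹) * g ∈ preSL Γ := fun n =>
    mul_mem (mul_mem (inv_mem hg) (conj_translation_mem hT n)) hg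
  set e : ℕ → preSL Γ := fun n => ⟨g⁻¹ * (σ * translation n * σ⁻¹) * g, hmem n⟩ with he
  have hinj : Function.Injective e := by
    intro n m h
    have h1 : g⁻¹ * (σ * translation n * σ⁻¹) * g = g⁻¹ * (σ * translation m * σ⁻¹) * g :=
      congrArg Subtype.val h
    have h2 := mul_left_cancel (mul_right_cancel h1)
    have h3 := translation_injective (mul_left_cancel (mul_right_cancel h2))
    exact_mod_cast h3
  have hmaps : ∀ n ∈ Finset.range (⌊w.im⌋₊ + 1), e n ∈ hfin.toFinset := by
    intro n hn
    have hn' : (n : ℝ) ≤ w.im :=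
      (Nat.le_floor_iff w.im_pos.le).1 (Nat.lt_succ_iff.1 (Finset.mem_range.1 hn))
    rw [Set.Finite.mem_toFinset]
    refine ⟨e n • z, ⟨z, Metric.mem_closedBall_self zero_le_one, rfl⟩, ?_⟩
    have h1 : e n • z = (σ⁻¹ * g)⁻¹ • (translation n • w) := by
      rw [Subgroup.smul_def, hw, smul_smul, smul_smul]
      congr 1
      simp only [he]
      group
    have h2 : z = (σ⁻¹ * g)⁻¹ • w := by rw [hw, inv_smul_smul]
    change dist (e n • z) z ≤ 1
    calc dist (e n • z) z = dist ((σ⁻¹ * g)⁻¹ • (translation n • w)) ((σ⁻¹ * g)⁻¹ • w) := by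
          rw [← h2, h1]
      _ = dist (translation n • w) w := dist_smul _ _ _
      _ ≤ 1 := ?_
    exact dist_translation_smul_le (Nat.cast_nonneg n) hn'
  have hcard := Finset.card_le_card_of_injOn e hmaps hinj.injOn
  rw [Finset.card_range] at hcard
  calc w.im ≤ (⌊w.im⌋₊ + 1 : ℕ) := by push_cast; exact (Nat.lt_floor_add_one _).le
    _ ≤ _ := by exact_mod_cast hcard

/-! ### Absolute convergence -/

/-- The size `|z - conj τ| ^ (-r) y ^ p` of the terms of the series. -/
def termSize (τ : ℂ) (r p : ℝ) (z : ℍ) : ℝ := ‖(z : ℂ) - conj τ‖ ^ (-r) * z.im ^ p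

theorem termSize_nonneg (τ : ℂ) (r p : ℝ) (z : ℍ) : 0 ≤ termSize τ r p z := by
  have := z.im_pos
  unfold termSize
  positivity

theorem norm_sub_conj_pos {τ : ℂ} (hτ : 0 ≤ τ.im) (z : ℍ) : 0 < ‖(z : ℂ) - conj τ‖ := by
  refine norm_pos_iff.2 fun h => ?_
  have := im_sub_conj_pos hτ z
  rw [h] at this
  simp at this

/-- The Euclidean distance of `z` and `w` is at most `Im w (e^d - 1)`, where `d` is their hyperbolic
distance, and `Im w ≤ |w - conj τ|` since `Im τ ≥ 0`. -/
theorem norm_sub_conj_le {τ : ℂ} (hτ : 0 ≤ τ.im) (z w : ℍ) :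
    ‖(z : ℂ) - conj τ‖ ≤ Real.exp (dist z w) * ‖(w : ℂ) - conj τ‖ := by
  have h1 := UpperHalfPlane.dist_coe_le z w
  have h2 : w.im ≤ ‖(w : ℂ) - conj τ‖ := by
    refine le_trans ?_ ((le_abs_self _).trans (Complex.abs_im_le_norm _))
    simp
    exact hτ
  have h3 : 0 ≤ Real.exp (dist z w) - 1 := by
    have := Real.one_le_exp (dist_nonneg (x := z) (y := w))
    linarith
  calc ‖(z : ℂ) - conj τ‖ = ‖((z : ℂ) - w) + ((w : ℂ) - conj τ)‖ := by ring_nf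
    _ ≤ ‖(z : ℂ) - w‖ + ‖(w : ℂ) - conj τ‖ := norm_add_le _ _
    _ ≤ ‖(w : ℂ) - conj τ‖ * (Real.exp (dist z w) - 1) + ‖(w : ℂ) - conj τ‖ := by
      rw [← dist_eq_norm]
      gcongr
      exact h1.trans (mul_le_mul_of_nonneg_right h2 h3)
    _ = _ := by ring

/-- A Harnack-type inequality. Its constant depends only on the hyperbolic distance, so it is the
same for all pairs `g • z`, `g • w`. -/
theorem termSize_le {τ : ℂ} (hτ : 0 ≤ τ.im) {r p : ℝ} (hr : 0 ≤ r) (hp : 0 ≤ p) (z w : ℍ) :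
    termSize τ r p z ≤ Real.exp (dist z w) ^ (r + p) * termSize τ r p w := by
  have h1 := norm_sub_conj_le hτ w z
  rw [dist_comm] at h1
  have h2 := UpperHalfPlane.im_le_im_mul_exp_dist z w
  have hz := norm_sub_conj_pos hτ z
  have hw := norm_sub_conj_pos hτ w
  have hzi := z.im_pos
  have hwi := w.im_pos
  have he := Real.exp_pos (dist z w)
  have h3 : ‖(z : ℂ) - conj τ‖ ^ (-r) ≤
      Real.exp (dist z w) ^ r * ‖(w : ℂ) - conj τ‖ ^ (-r) := by
    have := Real.rpow_le_rpow_of_nonpos hw h1 (neg_nonpos.2 hr)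
    rw [Real.mul_rpow he.le hz.le, Real.rpow_neg he.le] at this
    rwa [← inv_mul_le_iff₀ (by positivity)]
  have h4 : z.im ^ p ≤ w.im ^ p * Real.exp (dist z w) ^ p := by
    rw [← Real.mul_rpow hwi.le he.le]
    exact Real.rpow_le_rpow hzi.le h2 hp
  calc termSize τ r p z ≤ (Real.exp (dist z w) ^ r * ‖(w : ℂ) - conj τ‖ ^ (-r)) *
        (w.im ^ p * Real.exp (dist z w) ^ p) := by
        unfold termSize
        gcongr
    _ = _ := by
      rw [termSize, Real.rpow_add he]
      ring

theorem majorant_nonneg (τ : ℂ) (r p : ℝ) (z : ℍ) : 0 ≤ majorant τ r p z :=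
  mul_nonneg (termSize_nonneg τ r p z) (Real.exp_pos _).le

/-- Unfolding the integrable majorant yields one point `z₀` with a convergent orbit sum. Bounded
heights on the orbit of `z₀` remove the exponential factor, and comparability of sizes moves the
result to any `z`. -/
theorem summable_termSize {Γ : Subgroup PSL(2, ℝ)} (hd : DiscreteTopology (preSL Γ))
    {σ : SL(2, ℝ)} (hT : σ * translation 1 * σ⁻¹ ∈ preSL Γ) {F : Set ℍ}
    (hF : IsFundamentalDomain Γ F volume) {τ : ℂ} (hτ : 0 ≤ τ.im) {r p : ℝ} (hr : 1 < r)
    (hp : r < p) (z : ℍ) :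
    Summable fun γ : Γ => termSize τ r p (((toPSL σ)⁻¹ * (γ : PSL(2, ℝ))) • z) := by
  have hc : Countable Γ := countable_of_discrete hd
  obtain ⟨z₀, hz₀⟩ : ∃ z₀ : ℍ, Summable fun γ : Γ =>
      majorant τ r p (((toPSL σ)⁻¹ * (γ : PSL(2, ℝ))) • z₀) := by
    have hm := (continuous_majorant hτ r p).measurable
    have hl := lintegral_tsum_smul hF (toPSL σ)⁻¹ (u := fun z => ENNReal.ofReal (majorant τ r p z))
      hm.ennreal_ofReal
    have hfin : ∫⁻ z : ℍ, ENNReal.ofReal (majorant τ r p z) ≠ ⊤ :=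
      (integrable_majorant hτ hr hp).lintegral_lt_top.ne
    rw [← hl] at hfin
    have hae := ae_lt_top' (Measurable.aemeasurable (Measurable.tsum fun γ : Γ =>
      (hm.comp (measurable_const_smul ((toPSL σ)⁻¹ * (γ : PSL(2, ℝ))))).ennreal_ofReal)) hfin
    -- An almost-everywhere statement on `F` produces a point only because `F` is not null.
    have hne : (volume : Measure ℍ).restrict F ≠ 0 := by
      rw [Ne, Measure.restrict_eq_zero]
      refine hF.measure_ne_zero fun h0 => ?_
      exact isOpen_univ.measure_ne_zero volume Set.univ_nonempty (by rw [h0]; rfl)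
    have : (ae ((volume : Measure ℍ).restrict F)).NeBot := ae_neBot.2 hne
    obtain ⟨z₀, hz₀⟩ := hae.exists
    refine ⟨z₀, ?_⟩
    have h2 := ENNReal.summable_toReal hz₀.ne
    refine h2.congr fun γ => ?_
    exact ENNReal.toReal_ofReal (majorant_nonneg _ _ _ _)
  obtain ⟨A, hA⟩ := exists_im_smul_le hd hT z₀
  refine Summable.of_nonneg_of_le (fun γ => termSize_nonneg _ _ _ _) (fun γ => ?_)
    (hz₀.mul_left (Real.exp (dist z z₀) ^ (r + p) * Real.exp (Real.pi * A)))
  set g := (toPSL σ)⁻¹ * (γ : PSL(2, ℝ)) with hg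
  have h1 := termSize_le hτ (by linarith : 0 ≤ r) (by linarith : 0 ≤ p) (g • z) (g • z₀)
  rw [dist_toPSL_smul] at h1
  refine h1.trans ?_
  rw [mul_assoc]
  refine mul_le_mul_of_nonneg_left ?_ (by positivity)
  have h2 : majorant τ r p (g • z₀) =
      termSize τ r p (g • z₀) * Real.exp (-(Real.pi * (g • z₀).im)) := rfl
  have h3 : Real.exp (-(Real.pi * A)) ≤ Real.exp (-(Real.pi * (g • z₀).im)) := by
    refine Real.exp_le_exp.2 (neg_le_neg ?_)
    exact mul_le_mul_of_nonneg_left (hA γ) Real.pi_pos.le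
  have h4 := mul_le_mul_of_nonneg_left h3 (termSize_nonneg τ r p (g • z₀))
  rw [← h2, Real.exp_neg] at h4
  rw [mul_comm]
  rwa [← div_eq_mul_inv, div_le_iff₀ (Real.exp_pos _)] at h4

theorem norm_omegaTerm_le {k : ℤ} (hk : Even k) (σ : SL(2, ℝ)) (s : ℂ) {τ : ℂ} (hτ : 0 ≤ τ.im)
    (z : ℍ) (γ : PSL(2, ℝ)) :
    ‖omegaTerm σ k s τ z γ‖ ≤ Real.exp (Real.pi * |s.im|) * z.im ^ (-((k : ℝ) / 2)) *
      termSize τ s.re ((k : ℝ) / 2) (((toPSL σ)⁻¹ * γ) • z) := by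
  have h1 := norm_autPow hk ((toPSL σ)⁻¹ * γ) z
  have h2 := autPow_ne_zero hk ((toPSL σ)⁻¹ * γ) z
  unfold omegaTerm termSize
  set w := ((toPSL σ)⁻¹ * γ) • z
  have h3 := norm_cpow_neg_le (im_sub_conj_pos hτ w) s
  have hz := z.im_pos
  have hA : 0 < ‖autPow k ((toPSL σ)⁻¹ * γ) z‖ := norm_pos_iff.2 h2
  rw [one_div, mul_inv, ← Complex.cpow_neg, norm_mul, norm_inv]
  have h4 : ‖autPow k ((toPSL σ)⁻¹ * γ) z‖⁻¹ = z.im ^ (-((k : ℝ) / 2)) * w.im ^ ((k : ℝ) / 2) := by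
    rw [Real.rpow_neg hz.le, ← h1]
    have := w.im_pos
    field_simp
  rw [h4]
  have := w.im_pos
  calc _ ≤ (Real.exp (Real.pi * |s.im|) * ‖(w : ℂ) - conj τ‖ ^ (-s.re)) *
        (z.im ^ (-((k : ℝ) / 2)) * w.im ^ ((k : ℝ) / 2)) := by gcongr
    _ = _ := by ring

theorem summable_omegaTerm {Γ : Subgroup PSL(2, ℝ)} (hd : DiscreteTopology (preSL Γ))
    {σ : SL(2, ℝ)} (hT : σ * translation 1 * σ⁻¹ ∈ preSL Γ) {F : Set ℍ}
    (hF : IsFundamentalDomain Γ F volume) {k : ℤ} (hk : Even k) {s τ : ℂ} (hτ : 0 ≤ τ.im)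
    (hs : 1 < s.re) (hsk : s.re < (k : ℝ) / 2) (z : ℍ) :
    Summable fun γ : Γ => omegaTerm σ k s τ z γ :=
  Summable.of_norm_bounded ((summable_termSize hd hT hF hτ hs hsk z).mul_left _)
    fun γ => norm_omegaTerm_le hk σ s hτ z γ

/-! ### Expansions at a cusp -/

/-- The translate `f ∣[k] σ` is a cusp form for `σ⁻¹ Γ σ`; this is what gives it a Fourier expansion
of period one. -/
theorem one_mem_strictPeriods {Γ : Subgroup PSL(2, ℝ)} {σ : SL(2, ℝ)}
    (hT : σ * translation 1 * σ⁻¹ ∈ preSL Γ) :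
    (1 : ℝ) ∈ (ConjAct.toConjAct (σ : GL (Fin 2) ℝ)⁻¹ • preGL Γ).strictPeriods := by
  rw [Subgroup.mem_strictPeriods_iff, Subgroup.mem_pointwise_smul_iff_inv_smul_mem,
    ← ConjAct.toConjAct_inv, ConjAct.toConjAct_smul, inv_inv]
  refine ⟨_, hT, ?_⟩
  rw [map_mul, map_mul, map_inv]
  congr 2
  ext i j
  fin_cases i <;> fin_cases j <;> simp [translation] <;> rfl

theorem norm_slash_mul_rpow {k : ℤ} (hk : Even k) (f : ℍ → ℂ) (σ : SL(2, ℝ)) (z : ℍ) :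
    ‖(f ∣[k] (σ : GL (Fin 2) ℝ)) z‖ * z.im ^ ((k : ℝ) / 2) =
      ‖f (σ • z)‖ * (σ • z).im ^ ((k : ℝ) / 2) := by
  have h1 := norm_autPow hk (toPSL σ) z
  rw [toPSL_smul] at h1
  rw [SL_slash_apply, zpow_neg, ← autPow_toPSL hk, norm_mul, norm_inv, ← h1]
  have h2 : ‖autPow k (toPSL σ) z‖ ≠ 0 := norm_ne_zero_iff.2 (autPow_ne_zero hk _ z)
  field_simp

/-- High up, half of the decay `e^(-2πy)` absorbs `y^p`. Below a fixed height `e^(-πy)` is bounded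
from below, so the bound `C y^(-p)` suffices there. -/
theorem exists_decay_bound {φ : ℍ → ℂ} {p C : ℝ} (hb : ∀ z : ℍ, ‖φ z‖ * z.im ^ p ≤ C)
    (hdecay : φ =O[UpperHalfPlane.atImInfty] fun z => Real.exp (-2 * Real.pi * z.im)) :
    ∃ C' : ℝ, ∀ z : ℍ, ‖φ z‖ ≤ C' * (z.im ^ (-p) * Real.exp (-(Real.pi * z.im))) := by
  obtain ⟨D, hD0, hD⟩ := hdecay.exists_pos
  obtain ⟨A, hA⟩ := (UpperHalfPlane.atImInfty_mem _).1 hD.bound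
  have hlit := ((isLittleO_rpow_exp_pos_mul_atTop p Real.pi_pos).bound one_pos)
  obtain ⟨B, hB⟩ := Filter.eventually_atTop.1 hlit
  have hC0 : 0 ≤ C := le_trans (mul_nonneg (norm_nonneg _)
    (Real.rpow_nonneg UpperHalfPlane.I.im_pos.le _)) (hb UpperHalfPlane.I)
  refine ⟨D + C * Real.exp (Real.pi * max A B), fun z => ?_⟩
  have hz := z.im_pos
  rcases le_or_gt (max A B) z.im with h | h
  · have h1 : ‖φ z‖ ≤ D * ‖Real.exp (-2 * Real.pi * z.im)‖ := hA z ((le_max_left _ _).trans h)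
    have h2 := hB z.im ((le_max_right _ _).trans h)
    rw [Real.norm_of_nonneg (by positivity)] at h1
    rw [Real.norm_of_nonneg (by positivity), Real.norm_of_nonneg (by positivity), one_mul] at h2
    have h3 : Real.exp (-2 * Real.pi * z.im) ≤ z.im ^ (-p) * Real.exp (-(Real.pi * z.im)) := by
      rw [show -2 * Real.pi * z.im = -(Real.pi * z.im) + -(Real.pi * z.im) by ring, Real.exp_add,
        Real.rpow_neg hz.le, Real.exp_neg]
      gcongr
    calc ‖φ z‖ ≤ D * (z.im ^ (-p) * Real.exp (-(Real.pi * z.im))) := h1.trans (by gcongr)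
      _ ≤ _ := by
        refine mul_le_mul_of_nonneg_right ?_ (by positivity)
        have : 0 ≤ C * Real.exp (Real.pi * max A B) := by positivity
        linarith
  · have h1 : ‖φ z‖ ≤ C * z.im ^ (-p) := by
      rw [Real.rpow_neg hz.le, ← div_eq_mul_inv, le_div_iff₀ (by positivity)]
      exact hb z
    have h2 : 1 ≤ Real.exp (Real.pi * max A B) * Real.exp (-(Real.pi * z.im)) := by
      rw [← Real.exp_add]
      refine Real.one_le_exp ?_
      nlinarith [Real.pi_pos]
    have h3 : 0 ≤ C * z.im ^ (-p) := by positivity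
    calc ‖φ z‖ ≤ C * z.im ^ (-p) * 1 := by rwa [mul_one]
      _ ≤ C * z.im ^ (-p) * (Real.exp (Real.pi * max A B) * Real.exp (-(Real.pi * z.im))) := by
        gcongr
      _ = C * Real.exp (Real.pi * max A B) * (z.im ^ (-p) * Real.exp (-(Real.pi * z.im))) := by
        ring
      _ ≤ _ := by
        refine mul_le_mul_of_nonneg_right ?_ (by positivity)
        linarith

/-- Hecke's bound for the coefficients of a form `g` of period one with `g(z) y ^ p` bounded. -/
theorem norm_qExpansion_coeff_le {k : ℤ} {𝒢 : Subgroup (GL (Fin 2) ℝ)} (g : CuspForm 𝒢 k)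
    (h1 : (1 : ℝ) ∈ 𝒢.strictPeriods) {p C : ℝ} (hb : ∀ z : ℍ, ‖g z‖ * z.im ^ p ≤ C) {m : ℕ}
    (hm : 0 < m) :
    ‖(UpperHalfPlane.qExpansion 1 g).coeff m‖ ≤ Real.exp (2 * Real.pi) * C * (m : ℝ) ^ p := by
  have hm' : (0 : ℝ) < m := by exact_mod_cast hm
  -- Integrating at height `1/m` makes the exponential factor the constant `e^(2π)` and turns
  -- `y^(-p)` into `m^p`.
  rw [ModularFormClass.qExpansion_coeff_eq_intervalIntegral (t := 1 / m) g one_pos h1 m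
    (by positivity)]
  rw [Complex.ofReal_one, one_div_one, one_mul]
  have key : ∀ u ∈ Set.uIoc (0 : ℝ) 1,
      ‖1 / Function.Periodic.qParam 1 ((u : ℂ) + ((1 / m : ℝ) : ℂ) * Complex.I) ^ m *
        g ⟨(u : ℂ) + ((1 / m : ℝ) : ℂ) * Complex.I, by simpa using hm⟩‖ ≤
      Real.exp (2 * Real.pi) * C * (m : ℝ) ^ p := by
    intro u _
    rw [norm_mul, norm_div, norm_one, norm_pow, Function.Periodic.norm_qParam]
    have h2 := hb ⟨(u : ℂ) + ((1 / m : ℝ) : ℂ) * Complex.I, by simpa using hm⟩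
    have h3 : (UpperHalfPlane.im ⟨(u : ℂ) + ((1 / m : ℝ) : ℂ) * Complex.I, by simpa using hm⟩) =
        1 / m := by
      rw [← UpperHalfPlane.coe_im]
      simp
    rw [h3, Real.div_rpow zero_le_one hm'.le, Real.one_rpow, mul_one_div, div_le_iff₀ (by positivity)] at h2
    have h4 : 1 / Real.exp (-2 * Real.pi *
        ((u : ℂ) + ((1 / m : ℝ) : ℂ) * Complex.I).im / 1) ^ m = Real.exp (2 * Real.pi) := by
      rw [← Real.exp_nat_mul, one_div, ← Real.exp_neg]
      congr 1
      simp
      field_simp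
    rw [h4, mul_assoc]
    gcongr
  have h5 := intervalIntegral.norm_integral_le_of_norm_le_const key
  simpa using h5

theorem hasSum_fourier {k : ℤ} {𝒢 : Subgroup (GL (Fin 2) ℝ)} (g : CuspForm 𝒢 k)
    (h1 : (1 : ℝ) ∈ 𝒢.strictPeriods) (z : ℍ) :
    HasSum (fun m : ℕ => (UpperHalfPlane.qExpansion 1 g).coeff m *
      Complex.exp (2 * Real.pi * Complex.I * m * z)) (g z) := by
  have : Fact (IsCusp OnePoint.infty 𝒢) := ⟨𝒢.isCusp_of_mem_strictPeriods one_pos h1⟩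
  have h := ModularForm.hasSum_qExpansion g one_pos h1 z
  convert h using 2 with m
  rw [Function.Periodic.qParam, ← Complex.exp_nat_mul]
  congr 2
  push_cast
  ring

/-! ### The unfolding identity -/

/-- With `j = j(σ⁻¹ γ, z)`, passing to `σ⁻¹ γ z` produces `conj(j)^(-k)` from `conj f` and
`|j|^(2k)` from `y^k`. Their product `j^k` cancels the automorphy factor of the term. -/
theorem omegaTerm_mul {Γ : Subgroup PSL(2, ℝ)} {k : ℤ} (hk : Even k) (σ : SL(2, ℝ)) (s τ : ℂ)
    (f : CuspForm (preGL Γ) k) (z : ℍ) (γ : Γ) :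
    omegaTerm σ k s τ z γ * (conj (f z) * (z.im : ℂ) ^ k) =
      unfolded τ s k ((f : ℍ → ℂ) ∣[k] (σ : GL (Fin 2) ℝ)) (((toPSL σ)⁻¹ * (γ : PSL(2, ℝ))) • z) := by
  obtain ⟨g, hg⟩ := exists_toPSL_eq (γ : PSL(2, ℝ))
  have hgΓ : g ∈ preSL Γ := by
    rw [Subgroup.mem_comap, hg]
    exact γ.2
  have hM : (toPSL σ)⁻¹ * (γ : PSL(2, ℝ)) = toPSL (σ⁻¹ * g) := by rw [map_mul, map_inv, hg]
  have hslash : ((f : ℍ → ℂ) ∣[k] (σ : GL (Fin 2) ℝ)) ∣[k] ((σ⁻¹ * g : SL(2, ℝ)) : GL (Fin 2) ℝ) = f := by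
    rw [← SlashAction.slash_mul]
    have h1 : (σ : GL (Fin 2) ℝ) * ((σ⁻¹ * g : SL(2, ℝ)) : GL (Fin 2) ℝ) =
        Matrix.SpecialLinearGroup.toGL g := by
      rw [← map_mul, mul_inv_cancel_left]
    rw [h1]
    exact SlashInvariantFormClass.slash_action_eq f _ (Subgroup.mem_map_of_mem _ hgΓ)
  have hfz := congrFun hslash z
  rw [SL_slash_apply, zpow_neg] at hfz
  unfold omegaTerm unfolded
  rw [hM, autPow_toPSL hk, toPSL_smul, SL_im_smul, Complex.normSq_eq_norm_sq]
  set w := (σ⁻¹ * g) • z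
  set j := (((σ⁻¹ * g : SL(2, ℝ)) 1 0 : ℝ) : ℂ) * z + ((σ⁻¹ * g : SL(2, ℝ)) 1 1 : ℝ) with hj
  have hj0 : j ≠ 0 := SL_denom_ne_zero (σ⁻¹ * g) z
  have hjk : j ^ k ≠ 0 := zpow_ne_zero _ hj0
  have hjk' : conj j ^ k ≠ 0 := zpow_ne_zero _ ((map_ne_zero _).2 hj0)
  rw [← hfz, Complex.ofReal_div, Complex.ofReal_pow, ← Complex.conj_mul', div_zpow, mul_zpow,
    Complex.cpow_neg, map_mul, map_inv₀, map_zpow₀]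
  field_simp

/-- The Petersson product of the series with a cusp form `f` for which `|f(z)| y ^ (k / 2)` is
bounded. -/
theorem petersson_Omega_of_bounded {Γ : Subgroup PSL(2, ℝ)} (hd : DiscreteTopology (preSL Γ))
    {σ : SL(2, ℝ)} (hT : σ * translation 1 * σ⁻¹ ∈ preSL Γ) {F : Set ℍ}
    (hF : IsFundamentalDomain Γ F volume) {k : ℤ} (hk : Even k) {s τ : ℂ} (hτ : 0 ≤ τ.im)
    (hs : 1 < s.re) (hsk : s.re < (k : ℝ) / 2 - 1) (f : CuspForm (preGL Γ) k) {C : ℝ}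
    (hb : ∀ z : ℍ, ‖f z‖ * z.im ^ ((k : ℝ) / 2) ≤ C) :
    (∀ z : ℍ, Summable fun γ : Γ => omegaTerm σ k s τ z γ) ∧
        IntegrableOn (peterssonIntegrand k (Omega Γ σ k s τ) f) F volume ∧
        LSeriesSummable (twist (conjFourierCoeffAt σ k f) (-conj τ)) (k - s) ∧
        peterssonInner F k (Omega Γ σ k s τ) f =
          (2 : ℂ) ^ (2 - k) * Real.pi * Complex.exp (-(s * Complex.I * Real.pi / 2)) *
            (Complex.Gamma (k - 1) / (Complex.Gamma s * Complex.Gamma (k - s))) *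
            twistedLStar (conjFourierCoeffAt σ k f) (k - s) (-conj τ) := by
  have hcount : Countable Γ := countable_of_discrete hd
  set g := CuspForm.translate f (σ : GL (Fin 2) ℝ) with hg
  have hgφ : (g : ℍ → ℂ) = (f : ℍ → ℂ) ∣[k] (σ : GL (Fin 2) ℝ) := rfl
  have h1 := one_mem_strictPeriods hT
  have hgb : ∀ z : ℍ, ‖g z‖ * z.im ^ ((k : ℝ) / 2) ≤ C := fun z =>
    (norm_slash_mul_rpow hk f σ z).trans_le (hb (σ • z))
  have ha0 : fourierCoeffAt σ k f 0 = 0 := CuspFormClass.qExpansion_coeff_zero g one_pos h1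
  have ha : ∀ m : ℕ, 0 < m → ‖fourierCoeffAt σ k f m‖ ≤
      Real.exp (2 * Real.pi) * C * (m : ℝ) ^ ((k : ℝ) / 2) := fun m hm =>
    norm_qExpansion_coeff_le g h1 hgb hm
  have hdecay : (g : ℍ → ℂ) =O[UpperHalfPlane.atImInfty]
      fun z => Real.exp (-2 * Real.pi * z.im) := by
    have := CuspFormClass.exp_decay_atImInfty g one_pos h1
    simpa using this
  obtain ⟨C', hC'⟩ := exists_decay_bound hgb hdecay
  have hgc : Continuous g := (CuspFormClass.holo g).continuous
  have hum := continuous_unfolded hτ s k hgc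
  have hunf := hasSum_integral_smul hF (toPSL σ)⁻¹
    (integrable_unfolded hτ hs (by linarith) hgc hC') hum.measurable
  have hpt : ∀ z : ℍ, peterssonIntegrand k (Omega Γ σ k s τ) f z =
      ∑' γ : Γ, unfolded τ s k g (((toPSL σ)⁻¹ * (γ : PSL(2, ℝ))) • z) := by
    intro z
    rw [peterssonIntegrand, Omega, mul_assoc, ← tsum_mul_right]
    exact tsum_congr fun γ => omegaTerm_mul hk σ s τ f z γ
  have hpt' := funext hpt
  refine ⟨summable_omegaTerm hd hT hF hk hτ hs (by linarith), ?_,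
    LSeriesSummable_twist hτ hsk ha0 ha, ?_⟩
  · rw [hpt']
    exact hunf.1
  · rw [peterssonInner, hpt', hunf.2]
    exact integral_unfolded hτ hs hsk hgc ha0 (hasSum_fourier g h1) ha hC'

/-! ### Boundedness of cusp forms for Fuchsian groups of the first kind -/

/-- A parabolic element fixing `∞` is `±` a translation. Squaring removes the sign, and negation
makes the period positive. -/
theorem exists_pos_mem_strictPeriods {𝒢 : Subgroup (GL (Fin 2) ℝ)}
    (hdet : ∀ g ∈ 𝒢, g.det = 1 ∨ g.det = -1) (hc : IsCusp OnePoint.infty 𝒢) :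
    ∃ h : ℝ, 0 < h ∧ h ∈ 𝒢.strictPeriods := by
  obtain ⟨g, hg, hgp, hgi⟩ := hc
  rw [OnePoint.smul_infty_eq_self_iff] at hgi
  rw [Matrix.GeneralLinearGroup.isParabolic_iff_of_upperTriangular_of_det (hdet g hg) hgi] at hgp
  obtain ⟨x, hx, hxm⟩ : ∃ x : ℝ, x ≠ 0 ∧ x ∈ 𝒢.strictPeriods := by
    rcases hgp with ⟨x, hx, rfl⟩ | ⟨x, hx, rfl⟩
    · exact ⟨x, hx, Subgroup.mem_strictPeriods_iff.2 hg⟩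
    · refine ⟨2 • x, by simpa using hx, Subgroup.mem_strictPeriods_iff.2 ?_⟩
      simpa only [AddChar.map_nsmul_eq_pow, neg_sq] using pow_mem hg 2
  rcases lt_or_gt_of_ne hx with h | h
  · exact ⟨-x, neg_pos.2 h, neg_mem hxm⟩
  · exact ⟨x, h, hxm⟩

/-- Exponential decay of `f ∣[k] g` at `i∞` beats `y^(-k/2)`, so `|f| y^(k/2)` is small on a
horodisc at the cusp. -/
theorem exists_lt_of_isCusp {Γ : Subgroup PSL(2, ℝ)} {k : ℤ} (hk : Even k)
    (f : CuspForm (preGL Γ) k) (g : SL(2, ℝ))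
    (hc : IsCusp ((g : GL (Fin 2) ℝ) • (OnePoint.infty : OnePoint ℝ)) (preGL Γ)) :
    ∃ A : ℝ, ∀ z : ℍ, A < z.im → ‖f (g • z)‖ * (g • z).im ^ ((k : ℝ) / 2) < 1 := by
  have hc' := hc.smul (g : GL (Fin 2) ℝ)⁻¹
  rw [inv_smul_smul] at hc'
  obtain ⟨h, hh, hhm⟩ := exists_pos_mem_strictPeriods (fun p hp => by
    rw [Subgroup.mem_pointwise_smul_iff_inv_smul_mem, ← ConjAct.toConjAct_inv,
      ConjAct.toConjAct_smul, inv_inv] at hp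
    obtain ⟨q, -, hq⟩ := hp
    left
    have h1 := congrArg Matrix.GeneralLinearGroup.det hq
    simp only [map_mul, map_inv] at h1
    rw [mul_inv_cancel_comm] at h1
    rw [← h1]
    ext
    simp) hc'
  have hdec := CuspFormClass.exp_decay_atImInfty (CuspForm.translate f (g : GL (Fin 2) ℝ)) hh hhm
  have hexp : (fun z : ℍ => Real.exp (-2 * Real.pi * z.im / h)) =o[UpperHalfPlane.atImInfty]
      fun z : ℍ => z.im ^ (-((k : ℝ) / 2)) := by
    have h1 := (isLittleO_exp_neg_mul_rpow_atTop (a := 2 * Real.pi / h) (by positivity)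
      (-((k : ℝ) / 2))).comp_tendsto (Filter.tendsto_comap (f := UpperHalfPlane.im))
    refine h1.congr_left fun z => ?_
    simp only [Function.comp_apply]
    congr 1
    ring
  have h2 := (hdec.trans_isLittleO hexp).bound (show (0 : ℝ) < 1 / 2 by norm_num)
  obtain ⟨A, hA⟩ := (UpperHalfPlane.atImInfty_mem _).1 h2
  refine ⟨A, fun z hz => ?_⟩
  rw [← norm_slash_mul_rpow hk]
  have h3 : ‖((f : ℍ → ℂ) ∣[k] (g : GL (Fin 2) ℝ)) z‖ ≤ 1 / 2 * ‖z.im ^ (-((k : ℝ) / 2))‖ :=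
    hA z hz.le
  have h4 : 0 < z.im ^ ((k : ℝ) / 2) := Real.rpow_pos_of_pos z.im_pos _
  rw [Real.rpow_neg z.im_pos.le, norm_inv, Real.norm_of_nonneg h4.le, ← div_eq_mul_inv,
    le_div_iff₀ h4] at h3
  linarith

theorem norm_mul_rpow_smul {Γ : Subgroup PSL(2, ℝ)} {k : ℤ} (hk : Even k)
    (f : CuspForm (preGL Γ) k) {γ : PSL(2, ℝ)} (hγ : γ ∈ Γ) (z : ℍ) :
    ‖f (γ • z)‖ * (γ • z).im ^ ((k : ℝ) / 2) = ‖f z‖ * z.im ^ ((k : ℝ) / 2) := by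
  obtain ⟨g, rfl⟩ := exists_toPSL_eq γ
  have h1 := norm_slash_mul_rpow hk f g z
  have hg : g ∈ preSL Γ := hγ
  rw [SlashInvariantFormClass.slash_action_eq f _ (Subgroup.mem_map_of_mem _ hg)] at h1
  exact h1.symm

/-- The function `|f| y^(k/2)` is `Γ`-invariant, and its sublevel sets together with all cusps are
open in `ℍ*` by its smallness on horodiscs. They form an increasing open cover of the compact
quotient, so one of them is everything. -/
theorem exists_bound_of_isFuchsianFirstKind {Γ : Subgroup PSL(2, ℝ)} (hΓ : IsFuchsianFirstKind Γ)
    {k : ℤ} (hk : Even k) (f : CuspForm (preGL Γ) k) :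
    ∃ C : ℝ, ∀ z : ℍ, ‖f z‖ * z.im ^ ((k : ℝ) / 2) ≤ C := by
  have := hΓ.compact
  set h : ℍ → ℝ := fun z => ‖f z‖ * z.im ^ ((k : ℝ) / 2) with hh
  have hcont : Continuous h := by
    refine (CuspFormClass.holo f).continuous.norm.mul ?_
    exact UpperHalfPlane.continuous_im.rpow_const fun z => Or.inl z.im_pos.ne'
  -- The level is `n + 1` so that already for `n = 0` the set contains the horodiscs on which the
  -- function is below `1`.
  let P : ℕ → ExtHalfPlane Γ → Prop := fun n x => match x with
    | .point z => h z < n + 1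
    | .cusp _ _ => True
  have hP : ∀ n x y, orbitRel Γ x y → P n x = P n y := by
    rintro n (z | ⟨c, hc⟩) (w | ⟨d, hd⟩) hxy
    · obtain ⟨γ, hγ, rfl⟩ := hxy
      change (h z < n + 1) = (h (γ • z) < n + 1)
      rw [hh]
      simp only [norm_mul_rpow_smul hk f hγ z]
    · exact hxy.elim
    · exact hxy.elim
    · rfl
  let U : ℕ → Set (Quot (orbitRel Γ)) := fun n => {q | Quot.lift (P n) (hP n) q}
  have hU : ∀ n, IsOpen (U n) := by
    intro n
    refine isOpen_coinduced.2 ⟨isOpen_lt hcont continuous_const, fun c hc _ g hg => ?_⟩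
    subst hg
    obtain ⟨A, hA⟩ := exists_lt_of_isCusp hk f g hc
    refine ⟨A, fun z hz => (hA z hz).trans_le ?_⟩
    simp
  have hcover : (Set.univ : Set (Quot (orbitRel Γ))) ⊆ ⋃ n, U n := by
    rintro ⟨x⟩ -
    rw [Set.mem_iUnion]
    rcases x with z | ⟨c, hc⟩
    · obtain ⟨n, hn⟩ := exists_nat_gt (h z)
      exact ⟨n, hn.trans (lt_add_one _)⟩
    · exact ⟨0, trivial⟩
  have hmono : Monotone U := by
    rintro m n hmn ⟨z | ⟨c, hc⟩⟩ hx
    · have h1 : h z < m + 1 := hx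
      have h2 : (m : ℝ) ≤ n := by exact_mod_cast hmn
      exact show h z < n + 1 by linarith
    · exact trivial
  obtain ⟨n, hn⟩ := isCompact_univ.elim_directed_cover U hU hcover hmono.directed_le
  refine ⟨n + 1, fun z => ?_⟩
  have h1 : h z < n + 1 := hn (Set.mem_univ (Quot.mk _ (ExtHalfPlane.point z)))
  exact h1.le

theorem IsScalingMatrix.conj_translation_one {Γ : Subgroup PSL(2, ℝ)} {a : OnePoint ℝ}
    {σ : SL(2, ℝ)} (h : IsScalingMatrix Γ a σ) : σ * translation 1 * σ⁻¹ ∈ preSL Γ :=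
  ((h.conj_stabilizer (translation 1)).2 ⟨1, Or.inl (by simp [translation])⟩).1

/-! ### The series as a modular form -/

theorem autPow_mul {k : ℤ} (hk : Even k) (g h : PSL(2, ℝ)) (z : ℍ) :
    autPow k (g * h) z = autPow k g (h • z) * autPow k h z := by
  obtain ⟨g, rfl⟩ := exists_toPSL_eq g
  obtain ⟨h, rfl⟩ := exists_toPSL_eq h
  rw [← map_mul, autPow_toPSL hk, autPow_toPSL hk, autPow_toPSL hk, ← mul_zpow, toPSL_smul,
    SL_smul_coe]
  congr 1
  have h1 := SL_denom_ne_zero h z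
  simp only [Matrix.SpecialLinearGroup.coe_mul, Matrix.mul_apply, Fin.sum_univ_two]
  push_cast
  field_simp
  ring

/-- The cocycle relation and reindexing by right multiplication; as a statement about `tsum` under a
bijection, it needs no convergence. -/
theorem Omega_slash {Γ : Subgroup PSL(2, ℝ)} {k : ℤ} (hk : Even k) (σ : SL(2, ℝ)) (s τ : ℂ)
    {g : SL(2, ℝ)} (hg : g ∈ preSL Γ) :
    (Omega Γ σ k s τ) ∣[k] (g : GL (Fin 2) ℝ) = Omega Γ σ k s τ := by
  funext z
  rw [SL_slash_apply, zpow_neg, ← autPow_toPSL hk, Omega, Omega, ← tsum_mul_right,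
    ← (Equiv.mulRight (⟨toPSL g, hg⟩ : Γ)).tsum_eq fun γ : Γ => omegaTerm σ k s τ z γ]
  refine tsum_congr fun γ => ?_
  simp only [Equiv.coe_mulRight, Subgroup.coe_mul, omegaTerm]
  rw [← mul_assoc, autPow_mul hk _ (toPSL g), mul_smul _ (toPSL g), toPSL_smul, one_div, one_div,
    ← mul_inv, mul_assoc]

theorem differentiableOn_omegaTerm {k : ℤ} (hk : Even k) (σ : SL(2, ℝ)) (s : ℂ) {τ : ℂ}
    (hτ : 0 ≤ τ.im) (γ : PSL(2, ℝ)) :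
    DifferentiableOn ℂ (fun w : ℂ => omegaTerm σ k s τ (UpperHalfPlane.ofComplex w) γ)
      {w | 0 < w.im} := by
  obtain ⟨g, hg⟩ := exists_toPSL_eq ((toPSL σ)⁻¹ * γ)
  have h1 : Set.EqOn (fun w : ℂ => omegaTerm σ k s τ (UpperHalfPlane.ofComplex w) γ)
      (fun w => 1 / ((((g 0 0 : ℂ) * w + g 0 1) / ((g 1 0 : ℂ) * w + g 1 1) - conj τ) ^ s *
        ((g 1 0 : ℂ) * w + g 1 1) ^ k)) {w | 0 < w.im} := by
    intro w hw
    simp only [omegaTerm]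
    rw [← hg, autPow_toPSL hk, toPSL_smul, SL_smul_coe, UpperHalfPlane.ofComplex_apply_of_im_pos hw]
  refine DifferentiableOn.congr (fun w hw => DifferentiableAt.differentiableWithinAt ?_) h1
  have h2 := SL_denom_ne_zero g ⟨w, hw⟩
  have h3 := im_sub_conj_pos hτ (g • (⟨w, hw⟩ : ℍ))
  rw [SL_smul_coe] at h3
  change (g 1 0 : ℂ) * w + g 1 1 ≠ 0 at h2
  change 0 < (((g 0 0 : ℂ) * w + g 0 1) / ((g 1 0 : ℂ) * w + g 1 1) - conj τ).im at h3
  have h4 : (((g 0 0 : ℂ) * w + g 0 1) / ((g 1 0 : ℂ) * w + g 1 1) - conj τ) ∈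
      Complex.slitPlane := Or.inr h3.ne'
  have h5 : (((g 0 0 : ℂ) * w + g 0 1) / ((g 1 0 : ℂ) * w + g 1 1) - conj τ) ^ s ≠ 0 :=
    Complex.cpow_ne_zero_iff.2 (Or.inl (Complex.slitPlane_ne_zero h4))
  refine (differentiableAt_const _).div (DifferentiableAt.mul ?_ ?_)
    (mul_ne_zero h5 (zpow_ne_zero _ h2))
  · refine DifferentiableAt.cpow ?_ (differentiableAt_const _) h4
    exact DifferentiableAt.sub (by fun_prop (disch := exact h2)) (differentiableAt_const _)
  · exact DifferentiableAt.zpow (by fun_prop) (Or.inl h2)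

/-- Weierstrass's theorem: on the hyperbolic unit ball about `z₀`, every term is bounded by a fixed
multiple of its size at `z₀`. The factor `e^(-1)` is the worst ratio of heights in that ball. -/
theorem mdifferentiable_Omega {Γ : Subgroup PSL(2, ℝ)} (hd : DiscreteTopology (preSL Γ))
    {σ : SL(2, ℝ)} (hT : σ * translation 1 * σ⁻¹ ∈ preSL Γ) {F : Set ℍ}
    (hF : IsFundamentalDomain Γ F volume) {k : ℤ} (hk : Even k) {s τ : ℂ} (hτ : 0 ≤ τ.im)
    (hs : 1 < s.re) (hsk : s.re < (k : ℝ) / 2) : MDiff (Omega Γ σ k s τ) := by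
  rw [UpperHalfPlane.mdifferentiable_iff]
  intro w hw
  set z₀ : ℍ := ⟨w, hw⟩
  set U : Set ℂ := UpperHalfPlane.coe '' Metric.ball z₀ 1
  have hU : IsOpen U := UpperHalfPlane.isOpenEmbedding_coe.isOpenMap _ Metric.isOpen_ball
  have hwU : w ∈ U := ⟨z₀, Metric.mem_ball_self one_pos, rfl⟩
  have hUpos : U ⊆ {w | 0 < w.im} := by
    rintro _ ⟨z, -, rfl⟩
    exact z.im_pos
  have hp : 0 < (k : ℝ) / 2 := by linarith
  have hsum := (summable_termSize hd hT hF hτ hs hsk z₀).mul_left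
    (Real.exp (Real.pi * |s.im|) * (z₀.im * Real.exp (-1)) ^ (-((k : ℝ) / 2)) *
      Real.exp 1 ^ (s.re + (k : ℝ) / 2))
  have hdiff := Complex.differentiableOn_tsum_of_summable_norm hsum
    (fun γ : Γ => (differentiableOn_omegaTerm hk σ s hτ (γ : PSL(2, ℝ))).mono hUpos) hU ?_
  · exact (hdiff.differentiableAt (hU.mem_nhds hwU)).differentiableWithinAt
  · rintro γ _ ⟨z, hz, rfl⟩
    rw [UpperHalfPlane.ofComplex_apply]
    have hz' : dist z z₀ < 1 := hz
    refine (norm_omegaTerm_le hk σ s hτ z γ).trans ?_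
    have h1 := termSize_le hτ (by linarith : 0 ≤ s.re) hp.le
      (((toPSL σ)⁻¹ * (γ : PSL(2, ℝ))) • z) (((toPSL σ)⁻¹ * (γ : PSL(2, ℝ))) • z₀)
    rw [dist_toPSL_smul] at h1
    have h2 : Real.exp (dist z z₀) ^ (s.re + (k : ℝ) / 2) ≤ Real.exp 1 ^ (s.re + (k : ℝ) / 2) := by
      gcongr
    have h3 : z.im ^ (-((k : ℝ) / 2)) ≤ (z₀.im * Real.exp (-1)) ^ (-((k : ℝ) / 2)) := by
      refine Real.rpow_le_rpow_of_nonpos (mul_pos z₀.im_pos (Real.exp_pos _)) ?_ (by linarith)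
      rw [Real.exp_neg, ← div_eq_mul_inv, div_le_iff₀ (Real.exp_pos _)]
      refine (UpperHalfPlane.im_le_im_mul_exp_dist z₀ z).trans ?_
      rw [dist_comm]
      have := z.im_pos
      gcongr
    have h4 := termSize_nonneg τ s.re ((k : ℝ) / 2) (((toPSL σ)⁻¹ * (γ : PSL(2, ℝ))) • z₀)
    have h5 : 0 ≤ z.im ^ (-((k : ℝ) / 2)) := Real.rpow_nonneg z.im_pos.le _
    have h6 : 0 ≤ (z₀.im * Real.exp (-1)) ^ (-((k : ℝ) / 2)) := h5.trans h3
    calc _ ≤ Real.exp (Real.pi * |s.im|) * (z₀.im * Real.exp (-1)) ^ (-((k : ℝ) / 2)) *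
          (Real.exp 1 ^ (s.re + (k : ℝ) / 2) *
            termSize τ s.re ((k : ℝ) / 2) (((toPSL σ)⁻¹ * (γ : PSL(2, ℝ))) • z₀)) := by
          have h7 := h1.trans (mul_le_mul_of_nonneg_right h2 h4)
          have h8 := termSize_nonneg τ s.re ((k : ℝ) / 2) (((toPSL σ)⁻¹ * (γ : PSL(2, ℝ))) • z)
          gcongr
      _ = _ := by ring

/-! ### Vanishing at infinity -/

/-- From `q = (p x + q) - p x` and `x^2 ≤ 1/4`, `p^2 + q^2 ≤ 2 (p x + q)^2 + (3/2) p^2`. In the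
strip this controls all terms by their values at `i`. -/
theorem norm_linear_I_le {p q : ℝ} {z : ℍ} (hre : |z.re| ≤ 1 / 2) (him : 1 ≤ z.im) :
    ‖(p : ℂ) * Complex.I + q‖ ≤ Real.sqrt 2 * ‖(p : ℂ) * z + q‖ := by
  rw [← Real.sqrt_sq (norm_nonneg ((p : ℂ) * z + q)), ← Real.sqrt_mul zero_le_two]
  refine Real.le_sqrt_of_sq_le ?_
  rw [← Complex.normSq_eq_norm_sq, ← Complex.normSq_eq_norm_sq, Complex.normSq_apply,
    Complex.normSq_apply]
  have h1 : ((p : ℂ) * z + q).re = p * z.re + q := by simp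
  have h2 : ((p : ℂ) * z + q).im = p * z.im := by simp
  rw [h1, h2]
  simp only [Complex.add_re, Complex.mul_re, Complex.ofReal_re, Complex.I_re, Complex.ofReal_im,
    Complex.I_im, Complex.add_im, Complex.mul_im]
  have h3 : z.re ^ 2 ≤ 1 / 4 := by
    rw [← sq_abs]
    nlinarith [abs_nonneg z.re]
  have h4 : p ^ 2 ≤ p ^ 2 * z.im ^ 2 := le_mul_of_one_le_right (sq_nonneg p) (by nlinarith)
  nlinarith [sq_nonneg (p * z.re + q + p * z.re), sq_nonneg p,
    mul_le_mul_of_nonneg_left h3 (sq_nonneg p), sq_nonneg (2 * p * z.re + q)]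

theorem im_le_norm_linear (p q : ℝ) (z : ℍ) : |p| * z.im ≤ ‖(p : ℂ) * z + q‖ := by
  have h2 : ((p : ℂ) * z + q).im = p * z.im := by simp
  refine le_trans ?_ (Complex.abs_im_le_norm _)
  rw [h2, abs_mul, abs_of_pos z.im_pos]

/-- The neighbourhoods of `i ∞` within the strip `|Re z| ≤ 1 / 2`. -/
def stripAtImInfty : Filter ℍ :=
  UpperHalfPlane.atImInfty ⊓ Filter.principal {z | |z.re| ≤ 1 / 2}

theorem eventually_stripAtImInfty :
    ∀ᶠ z in stripAtImInfty, |z.re| ≤ 1 / 2 ∧ 1 ≤ z.im :=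
  Filter.Eventually.and (Filter.mem_inf_of_right (Filter.mem_principal_self _))
    (Filter.mem_inf_of_left ((UpperHalfPlane.atImInfty_mem _).2 ⟨1, fun _ h => h⟩))

theorem tendsto_norm_linear_rpow {p : ℝ} (hp : p ≠ 0) (q : ℝ) {r : ℝ} (hr : 0 < r) :
    Filter.Tendsto (fun z : ℍ => ‖(p : ℂ) * z + q‖ ^ (-r)) stripAtImInfty (nhds 0) := by
  refine (tendsto_rpow_neg_atTop hr).comp ?_
  refine Filter.tendsto_atTop_mono (im_le_norm_linear p q) ?_
  refine Filter.Tendsto.const_mul_atTop (abs_pos.2 hp) ?_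
  exact Filter.tendsto_comap.mono_left inf_le_left

theorem norm_linear_rpow_le {p q : ℝ} (hpq : (p : ℂ) * Complex.I + q ≠ 0) {r : ℝ} (hr : 0 ≤ r)
    {z : ℍ} (hz : |z.re| ≤ 1 / 2 ∧ 1 ≤ z.im) :
    ‖(p : ℂ) * z + q‖ ^ (-r) ≤ Real.sqrt 2 ^ r * ‖(p : ℂ) * Complex.I + q‖ ^ (-r) := by
  have h1 := norm_linear_I_le (p := p) (q := q) hz.1 hz.2
  have h0 : 0 < ‖(p : ℂ) * Complex.I + q‖ := norm_pos_iff.2 hpq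
  have h2 := Real.rpow_le_rpow_of_nonpos h0 h1 (neg_nonpos.2 hr)
  rw [Real.mul_rpow (Real.sqrt_nonneg _) (norm_nonneg _), Real.rpow_neg (Real.sqrt_nonneg _)] at h2
  rwa [inv_mul_le_iff₀ (by positivity)] at h2

theorem SL_num_ne_zero (M : SL(2, ℝ)) (z : ℍ) : (M 0 0 : ℂ) * z + M 0 1 ≠ 0 := by
  intro h
  have h1 := (M • z).ne_zero
  rw [SL_smul_coe, h, zero_div] at h1
  exact h1 rfl

theorem termSize_zero_smul (M : SL(2, ℝ)) (r p : ℝ) (z : ℍ) :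
    z.im ^ (-p) * termSize 0 r p (M • z) =
      ‖(M 0 0 : ℂ) * z + M 0 1‖ ^ (-r) * ‖(M 1 0 : ℂ) * z + M 1 1‖ ^ (-(2 * p - r)) := by
  have h1 := norm_pos_iff.2 (SL_denom_ne_zero M z)
  have h2 := norm_pos_iff.2 (SL_num_ne_zero M z)
  have hz := z.im_pos
  rw [termSize, map_zero, sub_zero, SL_smul_coe, SL_im_smul, norm_div, Complex.normSq_eq_norm_sq,
    Real.div_rpow h2.le h1.le, Real.div_rpow hz.le (sq_nonneg _), Real.rpow_neg hz.le,
    ← Real.rpow_natCast, ← Real.rpow_mul h1.le, neg_sub, Real.rpow_sub h1, Real.rpow_neg h1.le]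
  have h3 : 0 < z.im ^ p := by positivity
  push_cast
  field_simp

/-- For `τ = 0` the size is `|az + b|^(-r) |cz + d|^(-(2p - r))`, with both exponents negative.
Since `a` and `c` are not both zero, one factor tends to `0` while the other stays bounded. -/
theorem tendsto_termSize {M : SL(2, ℝ)} {r p : ℝ} (hr : 0 < r) (hp : r < 2 * p) :
    Filter.Tendsto (fun z : ℍ => z.im ^ (-p) * termSize 0 r p (M • z)) stripAtImInfty
      (nhds 0) := by
  simp only [termSize_zero_smul]
  have hI : ∀ i, (M i 0 : ℂ) * Complex.I + M i 1 ≠ 0 := by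
    intro i
    fin_cases i
    · exact SL_num_ne_zero M UpperHalfPlane.I
    · exact SL_denom_ne_zero M UpperHalfPlane.I
  have hbd : ∀ i, ∀ t : ℝ, 0 ≤ t → Filter.IsBoundedUnder (· ≤ ·) stripAtImInfty
      (norm ∘ fun z : ℍ => ‖(M i 0 : ℂ) * z + M i 1‖ ^ (-t)) := by
    intro i t ht
    refine Filter.isBoundedUnder_of_eventually_le (a := Real.sqrt 2 ^ t *
      ‖(M i 0 : ℂ) * Complex.I + M i 1‖ ^ (-t)) ?_
    filter_upwards [eventually_stripAtImInfty] with z hz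
    simp only [Function.comp_apply]
    rw [Real.norm_of_nonneg (by positivity)]
    exact norm_linear_rpow_le (hI i) ht hz
  by_cases ha : M 0 0 = 0
  · have hc : M 1 0 ≠ 0 := by
      intro hc
      have := M.det_coe
      rw [Matrix.det_fin_two, ha, hc] at this
      simp at this
    exact (tendsto_norm_linear_rpow hc _ (by linarith)).zero_mul_isBoundedUnder_le
      (hbd 0 r hr.le) |>.congr fun z => mul_comm _ _
  · exact (tendsto_norm_linear_rpow ha _ hr).zero_mul_isBoundedUnder_le (hbd 1 _ (by linarith))

theorem termSize_smul_le {M : SL(2, ℝ)} {r p : ℝ} (hr : 0 ≤ r) (hp : r ≤ 2 * p) {z : ℍ}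
    (hz : |z.re| ≤ 1 / 2 ∧ 1 ≤ z.im) :
    z.im ^ (-p) * termSize 0 r p (M • z) ≤
      Real.sqrt 2 ^ (2 * p) * termSize 0 r p (M • UpperHalfPlane.I) := by
  have h0 := termSize_zero_smul M r p UpperHalfPlane.I
  rw [UpperHalfPlane.I_im, Real.one_rpow, one_mul, UpperHalfPlane.coe_I] at h0
  rw [termSize_zero_smul, h0]
  have h1 := norm_linear_rpow_le (SL_num_ne_zero M UpperHalfPlane.I) hr hz
  have h2 := norm_linear_rpow_le (SL_denom_ne_zero M UpperHalfPlane.I) (r := 2 * p - r)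
    (by linarith) hz
  calc _ ≤ (Real.sqrt 2 ^ r * ‖(M 0 0 : ℂ) * Complex.I + M 0 1‖ ^ (-r)) *
        (Real.sqrt 2 ^ (2 * p - r) * ‖(M 1 0 : ℂ) * Complex.I + M 1 1‖ ^ (-(2 * p - r))) := by
        gcongr
    _ = _ := by
      rw [show Real.sqrt 2 ^ (2 * p) = Real.sqrt 2 ^ r * Real.sqrt 2 ^ (2 * p - r) by
        rw [← Real.rpow_add (by positivity)]; ring_nf]
      ring

/-- Dominated convergence for series: each term tends to `0`, and the summable term sizes at `i`
dominate. -/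
theorem tendsto_Omega_strip {Γ : Subgroup PSL(2, ℝ)} (hd : DiscreteTopology (preSL Γ))
    (hT : translation 1 ∈ preSL Γ) {F : Set ℍ}
    (hF : IsFundamentalDomain Γ F volume) {k : ℤ} (hk : Even k) {s : ℂ}
    (hs : 1 < s.re) (hsk : s.re < (k : ℝ) / 2) :
    Filter.Tendsto (Omega Γ 1 k s 0) stripAtImInfty (nhds 0) := by
  have hsum := (summable_termSize (σ := 1) hd (by simpa using hT) hF (τ := 0) le_rfl hs hsk
    UpperHalfPlane.I).mul_left (Real.exp (Real.pi * |s.im|) * Real.sqrt 2 ^ (2 * ((k : ℝ) / 2)))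
  rw [show nhds (0 : ℂ) = nhds (∑' _ : Γ, (0 : ℂ)) by rw [tsum_zero]]
  refine tendsto_tsum_of_dominated_convergence hsum (fun γ => ?_) ?_
  · obtain ⟨M, hM⟩ := exists_toPSL_eq ((toPSL 1)⁻¹ * (γ : PSL(2, ℝ)))
    rw [tendsto_zero_iff_norm_tendsto_zero]
    refine squeeze_zero (fun _ => norm_nonneg _)
      (fun z => norm_omegaTerm_le hk 1 s (τ := 0) le_rfl z γ) ?_
    rw [← hM]
    have := (tendsto_termSize (M := M) (r := s.re) (p := (k : ℝ) / 2) (by linarith)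
      (by linarith)).const_mul (Real.exp (Real.pi * |s.im|))
    rw [mul_zero] at this
    exact this.congr fun z => (mul_assoc _ _ _).symm
  · filter_upwards [eventually_stripAtImInfty] with z hz γ
    obtain ⟨M, hM⟩ := exists_toPSL_eq ((toPSL 1)⁻¹ * (γ : PSL(2, ℝ)))
    refine (norm_omegaTerm_le hk 1 s (τ := 0) le_rfl z γ).trans ?_
    rw [← hM, mul_assoc, mul_assoc]
    exact mul_le_mul_of_nonneg_left (termSize_smul_le (by linarith) (by linarith) hz)
      (Real.exp_pos _).le

theorem isZeroAtImInfty_Omega {Γ : Subgroup PSL(2, ℝ)} (hd : DiscreteTopology (preSL Γ))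
    (hT : translation 1 ∈ preSL Γ) {F : Set ℍ}
    (hF : IsFundamentalDomain Γ F volume) {k : ℤ} (hk : Even k) {s : ℂ}
    (hs : 1 < s.re) (hsk : s.re < (k : ℝ) / 2) :
    UpperHalfPlane.IsZeroAtImInfty (Omega Γ 1 k s 0) := by
  rw [UpperHalfPlane.isZeroAtImInfty_iff]
  intro ε hε
  have h1 := (tendsto_Omega_strip hd hT hF hk hs hsk).norm.eventually_lt_const
    (u := ε) (by simpa using hε)
  rw [stripAtImInfty, Filter.eventually_inf_principal] at h1
  obtain ⟨A, hA⟩ := (UpperHalfPlane.atImInfty_mem _).1 h1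
  refine ⟨A, fun z hz => ?_⟩
  -- Periodicity moves `z` into the strip without changing its height.
  set n : ℤ := -round z.re
  have hn : translation (n : ℝ) ∈ preSL Γ := by
    have hm : ∀ m : ℕ, translation (m : ℝ) ∈ preSL Γ := fun m => by
      simpa using conj_translation_mem (σ := 1) (by simpa using hT) m
    obtain ⟨m, hm' | hm'⟩ := n.eq_nat_or_neg
    · rw [hm']
      exact_mod_cast hm m
    · have h2 : translation (n : ℝ) = (translation (m : ℝ))⁻¹ := by
        rw [eq_inv_iff_mul_eq_one, ← translation_add, hm']
        push_cast
        rw [neg_add_cancel, translation_zero]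
      rw [h2]
      exact inv_mem (hm m)
  have h2 := congrFun (Omega_slash hk 1 s 0 hn) z
  rw [SL_slash_apply] at h2
  simp only [translation] at h2
  have h3 : Omega Γ 1 k s 0 (translation n • z) = Omega Γ 1 k s 0 z := by
    rw [← h2]
    simp [translation]
  rw [← h3]
  refine (hA (translation n • z) (by rwa [im_translation_smul]) ?_).le
  have h4 : (translation (n : ℝ) • z).re = z.re - round z.re := by
    rw [← UpperHalfPlane.coe_re, coe_translation_smul]
    simp [n, sub_eq_add_neg]
  change |(translation (n : ℝ) • z).re| ≤ 1 / 2
  rw [h4]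
  exact abs_sub_round _

/-! ### The modular group -/

theorem eq_or_eq_neg_of_toPSL_eq {g h : SL(2, ℝ)} (hgh : toPSL g = toPSL h) : g = h ∨ g = -h := by
  rw [QuotientGroup.mk'_eq_mk'] at hgh
  obtain ⟨u, hu, rfl⟩ := hgh
  rw [Matrix.SpecialLinearGroup.mem_center_iff] at hu
  obtain ⟨r, hr, hru⟩ := hu
  have hr' : r = 1 ∨ r = -1 := by simpa using hr
  rcases hr' with rfl | rfl
  · left
    have : u = 1 := by
      ext i j
      rw [← hru]
      simp
    rw [this, mul_one]
  · right
    have : u = -1 := by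
      ext i j
      rw [← hru]
      fin_cases i <;> fin_cases j <;> simp
    rw [this]
    simp

/-- No sign ambiguity survives, because `SL(2, ℤ)` contains `-1`. -/
theorem preSL_modularPSL :
    preSL modularPSL = (Matrix.SpecialLinearGroup.map (n := Fin 2) (Int.castRingHom ℝ)).range := by
  ext g
  constructor
  · rintro ⟨γ, hγ⟩
    rcases eq_or_eq_neg_of_toPSL_eq hγ with h | h
    · exact ⟨γ, h⟩
    · refine ⟨-γ, ?_⟩
      rw [← neg_eq_iff_eq_neg.2 h]
      ext i j
      simp
  · rintro ⟨γ, rfl⟩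
    exact ⟨γ, rfl⟩

theorem preGL_modularPSL : preGL modularPSL = 𝒮ℒ := by
  rw [preGL, preSL_modularPSL, MonoidHom.map_range]
  rfl

instance : (preGL modularPSL).IsArithmetic := by
  rw [preGL_modularPSL]
  infer_instance

theorem discrete_modularPSL : DiscreteTopology (preSL modularPSL) := by
  rw [preSL_modularPSL]
  infer_instance

theorem translation_one_mem_modularPSL : translation 1 ∈ preSL modularPSL := by
  rw [preSL_modularPSL]
  refine ⟨ModularGroup.T, ?_⟩
  ext i j
  change ((ModularGroup.T i j : ℤ) : ℝ) = _
  fin_cases i <;> fin_cases j <;> simp [translation, ModularGroup.T]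

/-- A neighbourhood of the standard fundamental domain; it meets every orbit of the modular group. -/
def siegelSet : Set ℍ := {z | |z.re| ≤ 1 / 2 ∧ 1 / 2 ≤ z.im}

theorem measurableSet_siegelSet : MeasurableSet siegelSet :=
  (measurableSet_le (UpperHalfPlane.continuous_re.abs.measurable) measurable_const).inter
    (measurableSet_le measurable_const UpperHalfPlane.continuous_im.measurable)

theorem exists_smul_mem_siegelSet (z : ℍ) : ∃ γ : modularPSL, (γ : PSL(2, ℝ)) • z ∈ siegelSet := by
  obtain ⟨g, hg⟩ := ModularGroup.exists_smul_mem_fd z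
  refine ⟨⟨toPSL (Matrix.SpecialLinearGroup.map (Int.castRingHom ℝ) g), g, rfl⟩, ?_⟩
  change g • z ∈ siegelSet
  refine ⟨hg.2, ?_⟩
  -- The height is at least `√3/2`, which leaves room for the bound `1/2`.
  have h1 := ModularGroup.three_le_four_mul_im_sq_of_mem_fd hg
  nlinarith [(g • z).im_pos]

theorem integrable_indicator_siegelSet :
    Integrable (siegelSet.indicator fun _ => (1 : ℝ)) := by
  rw [integrable_iff_coord]
  have h1 : IntegrableOn (fun _ : ℝ => (1 : ℝ)) (Set.Icc (-(1 / 2)) (1 / 2)) :=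
    integrableOn_const (by simp)
  have h2 : IntegrableOn (fun y : ℝ => y ^ (-2 : ℝ)) (Set.Ici (1 / 2)) :=
    (integrableOn_Ici_iff_integrableOn_Ioi (by simp)).2
      (integrableOn_Ioi_rpow_of_lt (by norm_num) (by norm_num))
  have h3 := (h1.integrable_indicator measurableSet_Icc).mul_prod
    ((h2.integrable_indicator measurableSet_Ici).mono_measure Measure.restrict_le_self :
      Integrable _ ((volume : Measure ℝ).restrict (Set.Ioi 0)))
  refine h3.congr ?_
  filter_upwards [ae_stripMeasure_pos] with q hq
  have hre : (UpperHalfPlane.ofComplex ((q.1 : ℂ) + q.2 * Complex.I)).re = q.1 := by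
    rw [← UpperHalfPlane.coe_re, coe_ofComplex_coord hq]
    simp
  have hmem : UpperHalfPlane.ofComplex ((q.1 : ℂ) + q.2 * Complex.I) ∈ siegelSet ↔
      q.1 ∈ Set.Icc (-(1 / 2) : ℝ) (1 / 2) ∧ q.2 ∈ Set.Ici (1 / 2 : ℝ) := by
    simp only [siegelSet, Set.mem_ofPred_eq, Set.mem_Icc, Set.mem_Ici]
    rw [im_ofComplex_coord hq, hre, abs_le]
  by_cases hm : UpperHalfPlane.ofComplex ((q.1 : ℂ) + q.2 * Complex.I) ∈ siegelSet
  · obtain ⟨h4, h5⟩ := hmem.1 hm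
    rw [Set.indicator_of_mem hm, Set.indicator_of_mem h4, Set.indicator_of_mem h5,
      Real.rpow_neg hq.le, Real.rpow_two, one_mul, smul_eq_mul, mul_one]
  · rw [Set.indicator_of_notMem hm, smul_zero]
    by_cases h4 : q.1 ∈ Set.Icc (-(1 / 2) : ℝ) (1 / 2)
    · rw [Set.indicator_of_notMem (s := Set.Ici (1 / 2 : ℝ)) fun h5 => hm (hmem.2 ⟨h4, h5⟩),
        mul_zero]
    · rw [Set.indicator_of_notMem h4, zero_mul]

/-- Unfold the indicator of `siegelSet`: its orbit sum is at least `1` everywhere, so `F` has at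
most the finite area of `siegelSet`. This works for an arbitrary fundamental domain. -/
theorem measure_fundamentalDomain_lt_top {F : Set ℍ}
    (hF : IsFundamentalDomain modularPSL F volume) : volume F < ⊤ := by
  have : Countable modularPSL := countable_of_discrete discrete_modularPSL
  have hm : Measurable (siegelSet.indicator fun _ => (1 : ENNReal)) :=
    measurable_const.indicator measurableSet_siegelSet
  have h1 := lintegral_tsum_smul hF 1 hm
  have h2 : ∫⁻ z, siegelSet.indicator (fun _ => (1 : ENNReal)) z = volume siegelSet := by
    rw [lintegral_indicator measurableSet_siegelSet]
    simp
  have h3 : volume siegelSet < ⊤ := by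
    have := (integrable_indicator_iff measurableSet_siegelSet).1 integrable_indicator_siegelSet
    rw [integrableOn_const_iff] at this
    simpa using this
  rw [h2] at h1
  refine lt_of_le_of_lt ?_ h3
  rw [← h1]
  calc volume F = ∫⁻ _ in F, 1 := by simp
    _ ≤ _ := by
      refine lintegral_mono fun z => ?_
      obtain ⟨γ, hγ⟩ := exists_smul_mem_siegelSet z
      refine le_trans ?_ (ENNReal.le_tsum γ)
      rw [one_mul, Set.indicator_of_mem hγ]

/-! ### Petersson products of cusp forms for the modular group -/

theorem exists_bound_modular {k : ℤ} (f : CuspForm (preGL modularPSL) k) :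
    ∃ C : ℝ, ∀ z : ℍ, ‖f z‖ * z.im ^ ((k : ℝ) / 2) ≤ C := by
  obtain ⟨C, hC⟩ := CuspFormClass.exists_bound f
  exact ⟨C, fun z => (le_div_iff₀ (Real.rpow_pos_of_pos z.im_pos _)).1 (hC z)⟩

theorem integrableOn_petersson {F : Set ℍ} (hF : IsFundamentalDomain modularPSL F volume) {k : ℤ}
    (f g : CuspForm (preGL modularPSL) k) : IntegrableOn (peterssonIntegrand k f g) F volume := by
  obtain ⟨C, hC⟩ := exists_bound_modular f
  obtain ⟨D, hD⟩ := exists_bound_modular g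
  have hcont : Continuous (peterssonIntegrand k f g) := by
    refine ((CuspFormClass.holo f).continuous.mul
      (Complex.continuous_conj.comp (CuspFormClass.holo g).continuous)).mul ?_
    exact (Complex.continuous_ofReal.comp UpperHalfPlane.continuous_im).zpow₀ k
      fun z => Or.inl (by simpa using z.im_pos.ne')
  refine Measure.integrableOn_of_bounded (M := C * D) (measure_fundamentalDomain_lt_top hF).ne
    hcont.aestronglyMeasurable (Filter.Eventually.of_forall fun z => ?_)
  have hz := z.im_pos
  have h1 : ‖peterssonIntegrand k f g z‖ =
      (‖f z‖ * z.im ^ ((k : ℝ) / 2)) * (‖g z‖ * z.im ^ ((k : ℝ) / 2)) := by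
    rw [peterssonIntegrand, norm_mul, norm_mul, RCLike.norm_conj, norm_zpow, Complex.norm_real,
      Real.norm_of_nonneg hz.le, ← Real.rpow_intCast,
      show (k : ℝ) = (k : ℝ) / 2 + (k : ℝ) / 2 by ring, Real.rpow_add hz]
    ring_nf
  rw [h1]
  exact mul_le_mul (hC z) (hD z) (by positivity) ((by positivity : (0 : ℝ) ≤ _).trans (hC z))

/-- The integrand is nonnegative, so `g` vanishes almost everywhere on `F`. The set where `g ≠ 0` is
`Γ`-invariant, hence null in `ℍ`; being open, it is empty. -/
theorem eq_zero_of_petersson_self {F : Set ℍ} (hF : IsFundamentalDomain modularPSL F volume)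
    {k : ℤ} (hk : Even k) {g : CuspForm (preGL modularPSL) k} (h : peterssonInner F k g g = 0) :
    g = 0 := by
  have : Countable modularPSL := countable_of_discrete discrete_modularPSL
  have h1 : ∀ z, peterssonIntegrand k g g z = ((‖g z‖ ^ 2 * z.im ^ k : ℝ) : ℂ) := by
    intro z
    rw [peterssonIntegrand, Complex.mul_conj']
    push_cast
    rfl
  have hint := integrableOn_petersson hF g g
  rw [peterssonInner] at h
  simp only [funext h1] at h hint
  have hint' : IntegrableOn (fun z : ℍ => ‖g z‖ ^ 2 * z.im ^ k) F volume :=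
    hint.re.congr (Filter.Eventually.of_forall fun z => Complex.ofReal_re _)
  rw [integral_complex_ofReal, Complex.ofReal_eq_zero, setIntegral_eq_zero_iff_of_nonneg_ae
    (Filter.Eventually.of_forall fun z => by have := z.im_pos; positivity)
    hint'] at h
  have hnull : volume {z : ℍ | g z ≠ 0} = 0 := by
    refine hF.measure_zero_of_invariant _ (fun γ => ?_) ?_
    · ext z
      rw [Set.mem_smul_set_iff_inv_smul_mem]
      have h2 := norm_mul_rpow_smul hk g (inv_mem γ.2) z
      have h3 := Real.rpow_pos_of_pos z.im_pos ((k : ℝ) / 2)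
      have h4 := Real.rpow_pos_of_pos ((γ : PSL(2, ℝ))⁻¹ • z).im_pos ((k : ℝ) / 2)
      change g ((γ : PSL(2, ℝ))⁻¹ • z) ≠ 0 ↔ g z ≠ 0
      rw [← norm_ne_zero_iff (a := g ((γ : PSL(2, ℝ))⁻¹ • z)), ← norm_ne_zero_iff (a := g z),
        ← mul_ne_zero_iff_right h4.ne', h2, mul_ne_zero_iff_right h3.ne']
    · rw [Filter.EventuallyEq, ae_iff, Measure.restrict_apply₀' hF.nullMeasurableSet] at h
      refine measure_mono_null (Set.inter_subset_inter_left _ fun z hz => ?_) h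
      have hz' : g z ≠ 0 := hz
      have := z.im_pos
      exact (show (0 : ℝ) < ‖g z‖ ^ 2 * z.im ^ k by positivity).ne'
  have hopen : IsOpen {z : ℍ | g z ≠ 0} :=
    isOpen_ne_fun (CuspFormClass.holo g).continuous continuous_const
  have hempty := hopen.eq_empty_of_measure_zero hnull
  ext z
  by_contra hz
  exact (hempty ▸ hz : z ∈ (∅ : Set ℍ))

/-! ### The cusp form of Cohen's series -/

theorem cohenSeries_slash {k : ℤ} (hk : Even k) (s : ℂ) {g : GL (Fin 2) ℝ}
    (hg : g ∈ preGL modularPSL) : (cohenSeries k s) ∣[k] g = cohenSeries k s := by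
  obtain ⟨g, hg, rfl⟩ := hg
  exact Omega_slash hk 1 s 0 hg

/-- Cohen's series as a cusp form. -/
def cohenForm {F : Set ℍ} (hF : IsFundamentalDomain modularPSL F volume) {k : ℤ} (hk : Even k)
    {s : ℂ} (hs : 1 < s.re) (hsk : s.re < (k : ℝ) / 2) : CuspForm (preGL modularPSL) k where
  toFun := cohenSeries k s
  slash_action_eq' _ hg := cohenSeries_slash hk s hg
  holo' := mdifferentiable_Omega discrete_modularPSL (by simpa using translation_one_mem_modularPSL)
    hF hk le_rfl hs hsk
  zero_at_cusps' {c} hc := by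
    -- All cusps of the modular group are equivalent to `∞`, so invariance reduces the condition to
    -- vanishing at `i∞`.
    rw [preGL_modularPSL] at hc
    obtain ⟨γ, rfl⟩ := isCusp_SL2Z_iff'.1 hc
    refine (OnePoint.isZeroAt_iff_exists_SL2Z hc).2 ⟨γ, rfl, ?_⟩
    have h1 := cohenSeries_slash hk s (g := Matrix.SpecialLinearGroup.mapGL ℝ γ)
      (by rw [preGL_modularPSL]; exact ⟨γ, rfl⟩)
    have h2 : (cohenSeries k s) ∣[k] γ = cohenSeries k s := h1
    rw [h2]
    exact isZeroAtImInfty_Omega discrete_modularPSL translation_one_mem_modularPSL hF hk hs hsk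

/-! ### The functional equation -/

theorem I_zpow_even {k : ℤ} (hk : Even k) : Complex.I ^ k = (-1 : ℂ) ^ (k / 2) := by
  obtain ⟨m, rfl⟩ := hk
  rw [zpow_add₀ Complex.I_ne_zero, ← mul_zpow, Complex.I_mul_I]
  congr 1
  omega

/-- The general functional equation relates `f` to `f ∣[k] S`, which is `f` itself in level one; the
sign is `i^k = (-1)^(k/2)`. -/
theorem completed_functional_equation {k : ℤ} (hk : Even k) (hk0 : 0 < k)
    (f : CuspForm (preGL modularPSL) k) (w : ℂ) :
    ModularForm.Λ hk0 f (k - w) = (-1 : ℂ) ^ (k / 2) * ModularForm.Λ hk0 f w := by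
  have h1 := (ModularForm.weakFEPair hk0 f).functional_equation w
  rw [(CuspForm.isStrongFEPair hk0 f).symm_Λ_eq] at h1
  have h2 : (ModularForm.weakFEPair hk0 f).g = fun t : ℝ =>
      f (UpperHalfPlane.ofComplex (Complex.I * t)) := by
    funext t
    have h3 : (f : ℍ → ℂ) ∣[k] (ModularGroup.S : GL (Fin 2) ℝ) = f :=
      SlashInvariantFormClass.slash_action_eq f _
        (by rw [preGL_modularPSL]; exact ⟨ModularGroup.S, rfl⟩)
    exact congrFun h3 _
  rw [h2] at h1
  rw [← I_zpow_even hk, CuspForm.Λ_eq_mellin, ← CuspForm.Λ_eq_mellin hk0 f]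
  rw [← CuspForm.Λ_eq_mellin hk0 f] at h1
  simpa [ModularForm.Λ] using h1

theorem conj_ofReal_cpow {x : ℝ} (hx : 0 ≤ x) (v : ℂ) :
    conj ((x : ℂ) ^ v) = (x : ℂ) ^ conj v := by
  rw [Complex.cpow_conj _ _ (by rw [Complex.arg_ofReal_of_nonneg hx]; exact Real.pi_ne_zero.symm),
    Complex.conj_ofReal]

/-- The reflection `z ↦ -conj z` fixes the imaginary axis, so conjugation passes through the Mellin
integral. -/
theorem LStar_conjForm {k : ℤ} (hk0 : 0 < k) (f : CuspForm (preGL modularPSL) k) (s : ℂ) :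
    LStar (conjForm f) s = conj (ModularForm.Λ hk0 f (conj s)) := by
  rw [CuspForm.Λ_eq_mellin, LStar, mellin, mellin, ← integral_conj]
  refine setIntegral_congr_fun measurableSet_Ioi fun t (ht : 0 < t) => ?_
  have h1 : UpperHalfPlane.J • UpperHalfPlane.ofComplex (Complex.I * t) =
      UpperHalfPlane.ofComplex (Complex.I * t) := by
    ext
    rw [UpperHalfPlane.coe_J_smul, UpperHalfPlane.ofComplex_apply_of_im_pos (by simpa using ht)]
    simp
  have h2 : ((t : ℂ) ^ (s - 1)) = conj ((t : ℂ) ^ (conj s - 1)) := by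
    rw [conj_ofReal_cpow ht.le]
    simp
  simp only [conjForm, smul_eq_mul, map_mul]
  rw [h1, ← h2]

/-- For `τ = 0` there is no twist. In the half-plane of the hypothesis, which contains `k - s`, the
two Dirichlet series agree term by term. -/
theorem twistedLStar_conjFourierCoeff {k : ℤ} (hk0 : 0 < k) (f : CuspForm (preGL modularPSL) k)
    {w : ℂ} (hw : (k : ℝ) / 2 + 1 < w.re) :
    twistedLStar (conjFourierCoeffAt 1 k f) w 0 = conj (ModularForm.Λ hk0 f (conj w)) := by
  have hwidth : (preGL modularPSL).strictWidthInfty = 1 := by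
    rw [preGL_modularPSL]
    exact Subgroup.strictWidthInfty_SL2Z
  have h1 := CuspForm.hasSum_Λ (s := conj w) f hk0 (by simpa using hw)
  rw [hwidth] at h1
  have h2 := h1.map (starRingEnd ℂ) Complex.continuous_conj
  rw [← h2.tsum_eq, twistedLStar, LSeries, ← tsum_mul_left]
  refine tsum_congr fun n => ?_
  have hcoeff : fourierCoeffAt 1 k f n = (UpperHalfPlane.qExpansion 1 f).coeff n := by
    rw [fourierCoeffAt, map_one, SlashAction.slash_one]
  have hre : 0 < w.re := by
    have : (0 : ℝ) < k := by exact_mod_cast hk0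
    linarith
  have hw0 : w ≠ 0 := by
    rintro rfl
    simp at hre
  rcases Nat.eq_zero_or_pos n with rfl | hn
  · simp [hw0]
  · rw [LSeries.term_of_ne_zero hn.ne', twist, conjFourierCoeffAt, hcoeff]
    simp only [Function.comp_apply, map_mul, map_div₀, mul_zero, Complex.exp_zero, mul_one, div_one]
    rw [conj_ofReal_cpow Real.pi_pos.le, conj_ofReal_cpow (by positivity), ← Complex.Gamma_conj,
      map_neg, Complex.conj_conj]
    push_cast
    rw [show (2 : ℂ) = ((2 : ℝ) : ℂ) by norm_num, show (n : ℂ) = ((n : ℝ) : ℂ) by norm_num,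
      Complex.mul_cpow_ofReal_nonneg zero_le_two n.cast_nonneg,
      Complex.mul_cpow_ofReal_nonneg zero_le_two Real.pi_pos.le, Complex.cpow_neg ((2 : ℝ) : ℂ)]
    have h3 : ((2 : ℝ) : ℂ) ^ w ≠ 0 := by simp [Complex.cpow_eq_zero_iff]
    field_simp

/-! ### The kernel of the completed `L`-function -/

/-- The constant relating Cohen's series to the kernel of the completed `L`-function. -/
def cohenConst (k : ℤ) (s : ℂ) : ℂ :=
  (2 : ℂ) ^ (2 - k) * (-1 : ℂ) ^ (k / 2) * Real.pi * Complex.exp (-(s * Complex.I * Real.pi / 2)) *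
    (Complex.Gamma (k - 1) / (Complex.Gamma s * Complex.Gamma (k - s)))

theorem cohenConst_ne_zero {k : ℤ} {s : ℂ} (hs : 1 < s.re) (hsk : s.re < (k : ℝ) / 2 - 1) :
    cohenConst k s ≠ 0 := by
  have h1 : Complex.Gamma ((k : ℂ) - 1) ≠ 0 := Complex.Gamma_ne_zero_of_re_pos (by
    rw [Complex.sub_re, Complex.intCast_re, Complex.one_re]; linarith)
  have h2 : Complex.Gamma s ≠ 0 := Complex.Gamma_ne_zero_of_re_pos (by linarith)
  have h3 : Complex.Gamma ((k : ℂ) - s) ≠ 0 := Complex.Gamma_ne_zero_of_re_pos (by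
    rw [Complex.sub_re, Complex.intCast_re]; linarith)
  have h4 : (Real.pi : ℂ) ≠ 0 := by exact_mod_cast Real.pi_ne_zero
  have h5 : (-1 : ℂ) ^ (k / 2) ≠ 0 := zpow_ne_zero _ (by norm_num)
  have h6 : (2 : ℂ) ^ (2 - k) ≠ 0 := zpow_ne_zero _ (by norm_num)
  exact mul_ne_zero (mul_ne_zero (mul_ne_zero (mul_ne_zero h6 h5) h4) (Complex.exp_ne_zero _))
    (div_ne_zero h1 (mul_ne_zero h2 h3))

/-- Unfolding gives the completed `L`-function at `k - s`; the functional equation moves it to `s`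
at the cost of `(-1)^(k/2)`. -/
theorem petersson_cohenSeries {F : Set ℍ} (hF : IsFundamentalDomain modularPSL F volume) {k : ℤ}
    (hk : Even k) {s : ℂ} (hs : 1 < s.re) (hsk : s.re < (k : ℝ) / 2 - 1)
    (f : CuspForm (preGL modularPSL) k) :
    peterssonInner F k (cohenSeries k s) f = cohenConst k s * LStar (conjForm f) s := by
  have hk0 : 0 < k := by
    have : (0 : ℝ) < k := by linarith
    exact_mod_cast this
  obtain ⟨C, hC⟩ := exists_bound_modular f
  have h1 := (petersson_Omega_of_bounded discrete_modularPSL (σ := 1) (by simpa using translation_one_mem_modularPSL) hF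
    hk (τ := 0) le_rfl hs hsk f hC).2.2.2
  rw [map_zero, neg_zero, twistedLStar_conjFourierCoeff hk0 f
    (by rw [Complex.sub_re, Complex.intCast_re]; linarith), map_sub, map_intCast (starRingEnd ℂ),
    completed_functional_equation hk hk0, map_mul, ← LStar_conjForm hk0] at h1
  have h2 : conj ((-1 : ℂ) ^ (k / 2)) = (-1 : ℂ) ^ (k / 2) := by simp
  rw [h2] at h1
  unfold cohenSeries cohenConst
  rw [h1]
  ring

theorem peterssonInner_const_mul (F : Set ℍ) (k : ℤ) (c : ℂ) (f g : ℍ → ℂ) :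
    peterssonInner F k (c • f) g = c * peterssonInner F k f g := by
  rw [peterssonInner, peterssonInner, ← integral_const_mul]
  refine integral_congr_ae (Filter.Eventually.of_forall fun z => ?_)
  simp only [peterssonIntegrand, Pi.smul_apply, smul_eq_mul]
  ring

/-- Pairing `D - E` with itself gives the difference of two equal values of `L*`, hence `0`. -/
theorem IsLStarKernel.eq {F : Set ℍ} (hF : IsFundamentalDomain modularPSL F volume) {k : ℤ}
    (hk : Even k) {s : ℂ} {D E : CuspForm (preGL modularPSL) k} (hD : IsLStarKernel F k s D)
    (hE : IsLStarKernel F k s E) : D = E := by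
  rw [← sub_eq_zero]
  refine eq_zero_of_petersson_self hF hk ?_
  have h1 : peterssonInner F k (D - E : CuspForm (preGL modularPSL) k)
      (D - E : CuspForm (preGL modularPSL) k) =
      peterssonInner F k D (D - E : CuspForm (preGL modularPSL) k) -
        peterssonInner F k E (D - E : CuspForm (preGL modularPSL) k) := by
    rw [peterssonInner, peterssonInner, peterssonInner,
      ← integral_sub (integrableOn_petersson hF _ _) (integrableOn_petersson hF _ _)]
    refine integral_congr_ae (Filter.Eventually.of_forall fun z => ?_)
    simp only [peterssonIntegrand, sub_apply]
    ring
  rw [h1, hD, hE, sub_self]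

/-- Existence is explicit: the kernel is Cohen's series divided by its nonzero constant, with no
appeal to duality in a finite-dimensional space. -/
theorem isLStarKernel_cohenForm {F : Set ℍ} (hF : IsFundamentalDomain modularPSL F volume) {k : ℤ}
    (hk : Even k) {s : ℂ} (hs : 1 < s.re) (hsk : s.re < (k : ℝ) / 2 - 1) :
    IsLStarKernel F k s
      ((cohenConst k s)⁻¹ • cohenForm hF hk hs (by linarith : s.re < (k : ℝ) / 2)) := by
  intro f
  have h1 : (((cohenConst k s)⁻¹ • cohenForm hF hk hs (by linarith : s.re < (k : ℝ) / 2) :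
      CuspForm (preGL modularPSL) k) : ℍ → ℂ) = (cohenConst k s)⁻¹ • cohenSeries k s := rfl
  rw [h1, peterssonInner_const_mul, petersson_cohenSeries hF hk hs hsk,
    inv_mul_cancel_left₀ (cohenConst_ne_zero hs hsk)]

end OmegaKernel

end

theorem proposition5p4 (k : ℤ) (hk : Even k) (s : ℂ) (hs1 : 1 < s.re)
    (hs2 : s.re < (k : ℝ) / 2 - 1) :
    (∀ (Γ : Subgroup PSL(2, ℝ)), OmegaKernel.IsFuchsianFirstKind Γ →
      ∀ (a : OnePoint ℝ) (σ : SL(2, ℝ)), OmegaKernel.IsScalingMatrix Γ a σ →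
      ∀ (F : Set ℍ), IsFundamentalDomain Γ F volume →
      ∀ (τ : ℂ), 0 ≤ τ.im → ∀ f : CuspForm (OmegaKernel.preGL Γ) k,
        (∀ z : ℍ, Summable fun γ : Γ => OmegaKernel.omegaTerm σ k s τ z γ) ∧
        IntegrableOn (OmegaKernel.peterssonIntegrand k (OmegaKernel.Omega Γ σ k s τ) f) F volume ∧
        LSeriesSummable (OmegaKernel.twist (OmegaKernel.conjFourierCoeffAt σ k f) (-conj τ))
          (k - s) ∧
        OmegaKernel.peterssonInner F k (OmegaKernel.Omega Γ σ k s τ) f =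
          (2 : ℂ) ^ (2 - k) * Real.pi * Complex.exp (-(s * Complex.I * Real.pi / 2)) *
            (Complex.Gamma (k - 1) / (Complex.Gamma s * Complex.Gamma (k - s))) *
            OmegaKernel.twistedLStar (OmegaKernel.conjFourierCoeffAt σ k f) (k - s) (-conj τ)) ∧
    (∀ (F : Set ℍ), IsFundamentalDomain OmegaKernel.modularPSL F volume →
      (∃! D : CuspForm (OmegaKernel.preGL OmegaKernel.modularPSL) k,
        OmegaKernel.IsLStarKernel F k s D) ∧
      ∀ D : CuspForm (OmegaKernel.preGL OmegaKernel.modularPSL) k,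
        OmegaKernel.IsLStarKernel F k s D → ∀ z : ℍ,
        OmegaKernel.cohenSeries k s z =
          (2 : ℂ) ^ (2 - k) * (-1 : ℂ) ^ (k / 2) * Real.pi *
            Complex.exp (-(s * Complex.I * Real.pi / 2)) *
            (Complex.Gamma (k - 1) / (Complex.Gamma s * Complex.Gamma (k - s))) * D z) := by
  refine ⟨fun Γ hΓ a σ hσ F hF τ hτ f => ?_, fun F hF => ⟨?_, fun D hD z => ?_⟩⟩
  · obtain ⟨C, hC⟩ := OmegaKernel.exists_bound_of_isFuchsianFirstKind hΓ hk f
    exact OmegaKernel.petersson_Omega_of_bounded hΓ.discrete hσ.conj_translation_one hF hk hτ hs1 hs2 f hC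
  · exact ⟨_, OmegaKernel.isLStarKernel_cohenForm hF hk hs1 hs2, fun D hD =>
      hD.eq hF hk (OmegaKernel.isLStarKernel_cohenForm hF hk hs1 hs2)⟩
  · have hconst := OmegaKernel.cohenConst_ne_zero hs1 hs2
    have h := congrArg (fun E : CuspForm (OmegaKernel.preGL OmegaKernel.modularPSL) k => E z)
      (hD.eq hF hk (OmegaKernel.isLStarKernel_cohenForm hF hk hs1 hs2))
    have h' : D z = (OmegaKernel.cohenConst k s)⁻¹ * OmegaKernel.cohenSeries k s z := h
    change _ = OmegaKernel.cohenConst k s * D z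
    rw [h', mul_inv_cancel_left₀ hconst]
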